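/- Let $\mathbb{S}^1=\mathbb{R}/\mathbb{Z}$ and write $[x]\in\mathbb{S}^1$ for the class of $x\in\mathbb{R}$. A lift of an orientation-preserving homeomorphism $f$ of $\mathbb{S}^1$ is an increasing continuous function $F:\mathbb{R}\to\mathbb{R}$ with $[F(x)]=f([x])$ for all $x\in\mathbb{R}$. The rotation number of $f$ is $[\tau(F)]\in\mathbb{S}^1$, where $F$ is a lift of $f$ and $\tau(F)=\lim_{n\to\infty}\frac{F^n(x)-x}{n}$ (the class does not depend on $F$ or $x$). Let $\mathcal{H}^\infty$ be the set of orientation-preserving $C^\infty$ diffeomorphisms of $\mathbb{S}^1$ with the metric $$d_\infty(f,g)=\sum_{k=1}^\infty \frac{d_k(f,g)}{2^k(1+d_k(f,g))},\qquad d_k(f,g)=\max\{\|f-g\|_k,\ \|f^{-1}-g^{-1}\|_k\},$$ where $\|f-g\|_k=\max_{0\le i\le k}\max_{x\in\mathbb{S}^1}|D^i(f-g)(x)|$; for $i=0$ the modulus is the distance on $\mathbb{S}^1$, and for $i\ge 1$ the derivatives are those of lifts. For $\alpha\in\mathbb{R}$ let $\mathcal{H}^\infty_\alpha\subset\mathcal{H}^\infty$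 be the subspace of diffeomorphisms with rotation number $[\alpha]$. For $f,g\in\mathcal{H}^\infty$ we say that - $f$ and $g$ are $C^\infty$-conjugate if $f=h\circ g\circ h^{-1}$ for some $h\in\mathcal{H}^\infty$; - $f$ and $g$ are Hölder-conjugate if $f=h\circ g\circ h^{-1}$ for some orientation-preserving homeomorphism $h$ of $\mathbb{S}^1$ that is $\beta$-Hölder continuous for some $\beta\in(0,1)$ (no Hölder condition is imposed on $h^{-1}$). **Proposition.** Let $\alpha\in\mathbb{R}$ be a Liouville number, that is, for every $n\in\mathbb{N}$ there are $p,q\in\mathbb{Z}$ with $q>1$ and $0<|\alpha-p/q|<q^{-n}$. Then there is a continuous injective map $\Psi:\{0,1\}^{\mathbb{N}}\to\mathcal{H}^\infty_\alpha$, where $\{0,1\}^{\mathbb{N}}$ carries the product topology, such that for any two sequences $a=(a_n)_{n\in\mathbb{N}}$ and $b=(b_n)_{n\in\mathbb{N}}$ in $\{0,1\}^{\mathbb{N}}$: 1. If there is $N\in\mathbb{N}$ with $a_n=b_n$ for all $n\ge N$, then $\Psi(a)$ and $\Psi(b)$ are $C^\infty$-conjugate. 2. If $a_n\ne b_n$ for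 infinitely many $n$, then $\Psi(a)$ and $\Psi(b)$ are not Hölder-conjugate. -/

import Mathlib

open scoped ContDiff NNReal

noncomputable section

namespace CircleDyn

/-- `F` is a lift of the circle map `f`: an increasing continuous map of the line with
`π ∘ F = f ∘ π`.  (`CircleDeg1Lift` bundles monotonicity and `F (x + 1) = F x + 1`; the latter
holds automatically for increasing lifts of circle homeomorphisms.) -/
def IsLift (F : CircleDeg1Lift) (f : UnitAddCircle → UnitAddCircle) : Prop :=
  Continuous F ∧ ∀ x : ℝ, ((F x : ℝ) : UnitAddCircle) = f (x : UnitAddCircle)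

/-- Orientation-preserving homeomorphisms of the circle `ℝ / ℤ`. -/
structure CircleHomeo where
  toHomeo : UnitAddCircle ≃ₜ UnitAddCircle
  exists_lift : ∃ F : CircleDeg1Lift, IsLift F toHomeo

/-- Two lifts of the same circle map differ by an integer constant, so that the notions below do
not depend on the lift that is chosen. -/
theorem IsLift.eq_add_int {F G : CircleDeg1Lift} {f : UnitAddCircle → UnitAddCircle}
    (hF : IsLift F f) (hG : IsLift G f) : ∃ m : ℤ, ∀ x, G x = F x + m := by
  have key : ∀ x, ∃ n : ℤ, (n : ℝ) = G x - F x := by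
    intro x
    have h : ((G x - F x : ℝ) : UnitAddCircle) = 0 := by
      rw [AddCircle.coe_sub, hG.2, hF.2, sub_self]
    obtain ⟨n, hn⟩ := (AddCircle.coe_eq_zero_iff (1 : ℝ)).1 h
    exact ⟨n, by simpa using hn⟩
  choose n hn using key
  have hc : Continuous n := by
    rw [Int.isClosedEmbedding_coe_real.isEmbedding.continuous_iff]
    have : ((fun k : ℤ => (k : ℝ)) ∘ n) = fun x => G x - F x := funext hn
    rw [this]
    exact hG.1.sub hF.1
  refine ⟨n 0, fun x => ?_⟩
  have h := PreconnectedSpace.constant (inferInstance : PreconnectedSpace ℝ) hc (x := x) (y := 0)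
  rw [← h, hn x]
  ring

namespace CircleHomeo

instance : CoeFun CircleHomeo (fun _ => UnitAddCircle → UnitAddCircle) :=
  ⟨fun f => f.toHomeo⟩

/-- A lift of `f`; it is unique up to an integer constant. -/
def lift (f : CircleHomeo) : CircleDeg1Lift := f.exists_lift.choose

theorem isLift_lift (f : CircleHomeo) : IsLift f.lift f := f.exists_lift.choose_spec

theorem lift_bijective (f : CircleHomeo) : Function.Bijective f.lift := by
  refine ⟨?_, f.lift.continuous_iff_surjective.1 f.isLift_lift.1⟩
  have aux : ∀ x y, f.lift x = f.lift y → x = y := by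
    intro x y hxy
    have h : f (x : UnitAddCircle) = f (y : UnitAddCircle) := by
      rw [← f.isLift_lift.2, ← f.isLift_lift.2, hxy]
    have h' : ((x - y : ℝ) : UnitAddCircle) = 0 := by
      rw [AddCircle.coe_sub, f.toHomeo.injective h, sub_self]
    obtain ⟨n, hn⟩ := (AddCircle.coe_eq_zero_iff (1 : ℝ)).1 h'
    have hx : x = y + n := by
      have : (n : ℝ) = x - y := by simpa using hn
      linarith
    rw [hx, f.lift.map_add_int] at hxy
    have : (n : ℝ) = 0 := by linarith
    rw [hx, this, add_zero]
  exact fun x y h => aux x y h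

/-- The inverse homeomorphism. -/
def symm (f : CircleHomeo) : CircleHomeo where
  toHomeo := f.toHomeo.symm
  exists_lift := by
    obtain ⟨u, hu⟩ := CircleDeg1Lift.isUnit_iff_bijective.2 f.lift_bijective
    refine ⟨(u⁻¹ : CircleDeg1Liftˣ), ?_, fun x => ?_⟩
    · exact (CircleDeg1Lift.continuous_iff_surjective _).2
        (CircleDeg1Lift.isUnit_iff_bijective.1 (Units.isUnit u⁻¹)).2
    · apply f.toHomeo.injective
      rw [f.toHomeo.apply_symm_apply]
      rw [← f.isLift_lift.2, ← hu, CircleDeg1Lift.units_apply_inv_apply]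

/-- The rotation number `[τ(F)] ∈ ℝ / ℤ`, where `F` is a lift of `f` and
`τ(F) = lim (F^n x - x) / n`. -/
def rotationNumber (f : CircleHomeo) : UnitAddCircle :=
  (f.lift.translationNumber : UnitAddCircle)

end CircleHomeo

/-- Orientation-preserving `C^∞` diffeomorphisms of the circle. -/
structure CircleDiffeo extends CircleHomeo where
  contDiff_lift : ContDiff ℝ ∞ toCircleHomeo.lift
  contDiff_lift_symm : ContDiff ℝ ∞ toCircleHomeo.symm.lift

namespace CircleHomeo

/-- `|D^i (f - g)|` at the point `[x]`.  For `i = 0` this is the distance on the circle, for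
`i ≥ 1` the derivatives are those of the lifts. -/
def derivGap (f g : CircleHomeo) : ℕ → ℝ → ℝ
  | 0, x => ‖f (x : UnitAddCircle) - g (x : UnitAddCircle)‖
  | i + 1, x => |iteratedDeriv (i + 1) f.lift x - iteratedDeriv (i + 1) g.lift x|

/-- `‖f - g‖_k = max_{0 ≤ i ≤ k} sup_x |D^i (f - g)(x)|`. -/
def normGap (k : ℕ) (f g : CircleHomeo) : ℝ :=
  (Finset.range (k + 1)).sup' Finset.nonempty_range_add_one (fun i => ⨆ x : ℝ, derivGap f g i x)

end CircleHomeo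

namespace CircleDiffeo

open CircleHomeo

instance : CoeFun CircleDiffeo (fun _ => UnitAddCircle → UnitAddCircle) :=
  ⟨fun f => f.toHomeo⟩

/-- The inverse diffeomorphism. -/
def symm (f : CircleDiffeo) : CircleDiffeo where
  toCircleHomeo := f.toCircleHomeo.symm
  contDiff_lift := f.contDiff_lift_symm
  contDiff_lift_symm := f.contDiff_lift

/-- `d_k(f, g) = max {‖f - g‖_k, ‖f⁻¹ - g⁻¹‖_k}`. -/
def distK (k : ℕ) (f g : CircleDiffeo) : ℝ :=
  max (normGap k f.toCircleHomeo g.toCircleHomeo)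
    (normGap k f.symm.toCircleHomeo g.symm.toCircleHomeo)

/-- `d_∞(f, g) = ∑_{k ≥ 1} d_k(f, g) / (2^k (1 + d_k(f, g)))`. -/
def distInf (f g : CircleDiffeo) : ℝ :=
  ∑' k : ℕ, distK (k + 1) f g / (2 ^ (k + 1) * (1 + distK (k + 1) f g))

theorem derivGap_nonneg (f g : CircleHomeo) (i : ℕ) (x : ℝ) : 0 ≤ derivGap f g i x := by
  cases i <;> simp [derivGap]

theorem derivGap_self (f : CircleHomeo) (i : ℕ) (x : ℝ) : derivGap f f i x = 0 := by
  cases i <;> simp [derivGap]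

theorem derivGap_comm (f g : CircleHomeo) (i : ℕ) (x : ℝ) :
    derivGap f g i x = derivGap g f i x := by
  cases i
  · exact norm_sub_rev _ _
  · exact abs_sub_comm _ _

theorem derivGap_triangle (f g h : CircleHomeo) (i : ℕ) (x : ℝ) :
    derivGap f h i x ≤ derivGap f g i x + derivGap g h i x := by
  cases i
  · exact norm_sub_le_norm_sub_add_norm_sub _ _ _
  · exact abs_sub_le _ _ _

theorem derivGap_bddAbove (f g : CircleDiffeo) (i : ℕ) :
    BddAbove (Set.range (derivGap f.toCircleHomeo g.toCircleHomeo i)) := by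
  cases i with
  | zero =>
    refine ⟨1 / 2, ?_⟩
    rintro _ ⟨x, rfl⟩
    have := AddCircle.norm_le_half_period (1 : ℝ) one_ne_zero
      (x := f (x : UnitAddCircle) - g (x : UnitAddCircle))
    simpa [derivGap] using this
  | succ i =>
    have hb : ∀ h : CircleDiffeo, ∃ C, ∀ x, |iteratedDeriv (i + 1) h.lift x| ≤ C := by
      intro h
      have hper : Function.Periodic (iteratedDeriv (i + 1) h.lift) 1 := by
        intro x
        have hd : Function.Periodic (deriv h.lift) 1 := by
          intro y
          rw [← deriv_comp_add_const]
          have : (fun z => h.lift (z + 1)) = fun z => h.lift z + 1 :=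
            funext fun z => h.lift.map_add_one z
          rw [this, deriv_add_const]
        rw [iteratedDeriv_succ']
        have h2 := congrFun (iteratedDeriv_comp_add_const i (deriv h.lift) 1) x
        rw [← h2]
        congr 1
        exact funext hd
      have hbd := hper.isBounded_of_continuous one_ne_zero
        (h.contDiff_lift.continuous_iteratedDeriv (i + 1) (by exact_mod_cast le_top))
      obtain ⟨C, hC⟩ := hbd.exists_norm_le
      exact ⟨C, fun x => hC _ ⟨x, rfl⟩⟩
    obtain ⟨C, hC⟩ := hb f
    obtain ⟨D, hD⟩ := hb g
    refine ⟨C + D, ?_⟩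
    rintro _ ⟨x, rfl⟩
    exact (abs_sub _ _).trans (add_le_add (hC x) (hD x))

theorem normGap_nonneg (k : ℕ) (f g : CircleHomeo) : 0 ≤ normGap k f g :=
  (Real.iSup_nonneg fun x => derivGap_nonneg f g 0 x).trans
    (Finset.le_sup' (fun i => ⨆ x : ℝ, derivGap f g i x) (Finset.mem_range.2 k.succ_pos))

theorem normGap_self (k : ℕ) (f : CircleHomeo) : normGap k f f = 0 := by
  simp [normGap, derivGap_self]

theorem normGap_comm (k : ℕ) (f g : CircleHomeo) : normGap k f g = normGap k g f := by
  simp only [normGap, derivGap_comm f g]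

theorem normGap_triangle (k : ℕ) (f g h : CircleDiffeo) :
    normGap k f.toCircleHomeo h.toCircleHomeo ≤
      normGap k f.toCircleHomeo g.toCircleHomeo + normGap k g.toCircleHomeo h.toCircleHomeo := by
  refine Finset.sup'_le _ _ fun i hi => ciSup_le fun x => ?_
  refine (derivGap_triangle _ g.toCircleHomeo _ i x).trans (add_le_add ?_ ?_)
  · exact (le_ciSup (derivGap_bddAbove f g i) x).trans
      (Finset.le_sup' (fun i => ⨆ x : ℝ, derivGap f.toCircleHomeo g.toCircleHomeo i x) hi)
  · exact (le_ciSup (derivGap_bddAbove g h i) x).trans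
      (Finset.le_sup' (fun i => ⨆ x : ℝ, derivGap g.toCircleHomeo h.toCircleHomeo i x) hi)

theorem distK_nonneg (k : ℕ) (f g : CircleDiffeo) : 0 ≤ distK k f g :=
  (normGap_nonneg k _ _).trans (le_max_left _ _)

theorem distK_triangle (k : ℕ) (f g h : CircleDiffeo) :
    distK k f h ≤ distK k f g + distK k g h :=
  max_le
    ((normGap_triangle k f g h).trans (add_le_add (le_max_left _ _) (le_max_left _ _)))
    ((normGap_triangle k f.symm g.symm h.symm).trans
      (add_le_add (le_max_right _ _) (le_max_right _ _)))

theorem term_nonneg (f g : CircleDiffeo) (k : ℕ) :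
    0 ≤ distK (k + 1) f g / (2 ^ (k + 1) * (1 + distK (k + 1) f g)) := by
  have := distK_nonneg (k + 1) f g
  positivity

theorem term_le (f g : CircleDiffeo) (k : ℕ) :
    distK (k + 1) f g / (2 ^ (k + 1) * (1 + distK (k + 1) f g)) ≤ (1 / 2 : ℝ) ^ k := by
  have := distK_nonneg (k + 1) f g
  rw [one_div, inv_pow, div_le_iff₀ (by positivity), pow_succ]
  have h2 : (2 ^ k : ℝ) ≠ 0 := by positivity
  field_simp
  linarith

theorem summable_term (f g : CircleDiffeo) :
    Summable fun k : ℕ => distK (k + 1) f g / (2 ^ (k + 1) * (1 + distK (k + 1) f g)) :=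
  Summable.of_nonneg_of_le (term_nonneg f g) (term_le f g) summable_geometric_two

theorem term_triangle (f g h : CircleDiffeo) (k : ℕ) :
    distK (k + 1) f h / (2 ^ (k + 1) * (1 + distK (k + 1) f h)) ≤
      distK (k + 1) f g / (2 ^ (k + 1) * (1 + distK (k + 1) f g)) +
        distK (k + 1) g h / (2 ^ (k + 1) * (1 + distK (k + 1) g h)) := by
  have key : ∀ a b c : ℝ, 0 ≤ a → 0 ≤ b → 0 ≤ c → c ≤ a + b →
      c / (1 + c) ≤ a / (1 + a) + b / (1 + b) := by
    intro a b c ha hb hc h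
    rw [div_add_div _ _ (by positivity) (by positivity),
      div_le_div_iff₀ (by positivity) (by positivity)]
    nlinarith [mul_nonneg ha hb, mul_nonneg (mul_nonneg ha hb) hc]
  have h := key _ _ _ (distK_nonneg (k + 1) f g) (distK_nonneg (k + 1) g h)
    (distK_nonneg (k + 1) f h) (distK_triangle (k + 1) f g h)
  simp only [mul_comm ((2 : ℝ) ^ (k + 1)), ← div_div]
  rw [← add_div]
  gcongr

theorem ext_of_forall {f g : CircleDiffeo} (h : ∀ x : UnitAddCircle, f x = g x) : f = g := by
  obtain ⟨⟨f, _⟩, _, _⟩ := f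
  obtain ⟨⟨g, _⟩, _, _⟩ := g
  obtain rfl : f = g := Homeomorph.ext h
  rfl

/-- The metric `d_∞`, which induces the `C^∞` topology. -/
instance : MetricSpace CircleDiffeo where
  dist := distInf
  dist_self f := by
    change distInf f f = 0
    simp [distInf, distK, normGap_self]
  dist_comm f g := by
    change distInf f g = distInf g f
    simp only [distInf, distK, normGap_comm _ f.toCircleHomeo,
      normGap_comm _ f.symm.toCircleHomeo]
  dist_triangle f g h := by
    change distInf f h ≤ distInf f g + distInf g h
    rw [distInf, distInf, distInf, ← (summable_term f g).tsum_add (summable_term g h)]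
    exact (summable_term f h).tsum_le_tsum (term_triangle f g h)
      ((summable_term f g).add (summable_term g h))
  eq_of_dist_eq_zero := by
    intro f g h
    change distInf f g = 0 at h
    have h1 := (summable_term f g).hasSum
    rw [show (∑' k : ℕ, distK (k + 1) f g / (2 ^ (k + 1) * (1 + distK (k + 1) f g))) = 0 from h,
      hasSum_zero_iff_of_nonneg (term_nonneg f g)] at h1
    have h2 := congrFun h1 0
    have hd := distK_nonneg (0 + 1) f g
    have h3 : distK (0 + 1) f g = 0 := by
      have hne : (2 ^ (0 + 1) * (1 + distK (0 + 1) f g) : ℝ) ≠ 0 := by positivity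
      exact (div_eq_zero_iff.1 h2).resolve_right hne
    refine ext_of_forall fun y => ?_
    obtain ⟨x, rfl⟩ := QuotientAddGroup.mk_surjective y
    have h4 : derivGap f.toCircleHomeo g.toCircleHomeo 0 x ≤ distK (0 + 1) f g :=
      ((le_ciSup (derivGap_bddAbove f g 0) x).trans
        (Finset.le_sup' (fun i => ⨆ x : ℝ, derivGap f.toCircleHomeo g.toCircleHomeo i x)
          (Finset.mem_range.2 (Nat.succ_pos _)))).trans (le_max_left _ _)
    rw [h3] at h4
    exact sub_eq_zero.1 (norm_le_zero_iff.1 h4)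

/-- `f` and `g` are `C^∞`-conjugate: `f = h ∘ g ∘ h⁻¹` for some orientation-preserving
`C^∞` diffeomorphism `h`. -/
def SmoothConjugate (f g : CircleDiffeo) : Prop :=
  ∃ h : CircleDiffeo, ∀ x : UnitAddCircle, f x = h (g (h.symm x))

/-- `f` and `g` are Hölder-conjugate: `f = h ∘ g ∘ h⁻¹` for some orientation-preserving
homeomorphism `h` that is `β`-Hölder continuous for some `0 < β < 1`. -/
def HolderConjugate (f g : CircleDiffeo) : Prop :=
  ∃ h : CircleHomeo, (∃ C β : ℝ≥0, 0 < β ∧ β < 1 ∧ HolderWith C β h) ∧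
    ∀ x : UnitAddCircle, f x = h (g (h.symm x))

end CircleDiffeo

/-- Orientation-preserving `C^∞` diffeomorphisms of the circle with rotation number `ρ`, with the
subspace topology. -/
abbrev DiffeoWithRotationNumber (ρ : UnitAddCircle) : Type :=
  {f : CircleDiffeo // f.toCircleHomeo.rotationNumber = ρ}

end CircleDyn

end

noncomputable section

open Filter Topology

namespace CircleDyn

/-- The family `u` grows at most polynomially in the scale `Q`, uniformly on the line. -/
def Moderate (Q : ℕ → ℝ) (u : ℕ → ℝ → ℝ) : Prop :=
  ∃ c : ℕ, ∀ᶠ j in atTop, ∀ x, |u j x| ≤ Q j ^ c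

/-- The family `u` decays faster than every power of the scale `Q`, uniformly on the line. -/
def Negligible (Q : ℕ → ℝ) (u : ℕ → ℝ → ℝ) : Prop :=
  ∀ c : ℕ, ∀ᶠ j in atTop, ∀ x, |u j x| ≤ (Q j ^ c)⁻¹

/-- The derivatives of the family `u` up to order `k` are moderate. -/
def ModerateUpTo (Q : ℕ → ℝ) (k : ℕ) (u : ℕ → ℝ → ℝ) : Prop :=
  ∀ i ≤ k, Moderate Q fun j => iteratedDeriv i (u j)

/-- A family of smooth functions all of whose derivatives are moderate. -/
structure SmoothModerate (Q : ℕ → ℝ) (u : ℕ → ℝ → ℝ) : Prop where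
  contDiff : ∀ j, ContDiff ℝ ∞ (u j)
  moderate : ∀ k, Moderate Q fun j => iteratedDeriv k (u j)

theorem contDiff_deriv_of_contDiff {f : ℝ → ℝ} (hf : ContDiff ℝ ∞ f) : ContDiff ℝ ∞ (deriv f) :=
  (contDiff_infty_iff_deriv.1 hf).2

theorem differentiable_of_contDiff {f : ℝ → ℝ} (hf : ContDiff ℝ ∞ f) : Differentiable ℝ f :=
  (contDiff_infty_iff_deriv.1 hf).1

section

variable {Q : ℕ → ℝ} {u v w : ℕ → ℝ → ℝ}

theorem Moderate.comp_right (hu : Moderate Q u) (w : ℕ → ℝ → ℝ) :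
    Moderate Q fun j x => u j (w j x) := by
  obtain ⟨c, hc⟩ := hu
  exact ⟨c, by filter_upwards [hc] with j h1 x using h1 _⟩

theorem Moderate.mul (hu : Moderate Q u) (hv : Moderate Q v) :
    Moderate Q fun j => u j * v j := by
  obtain ⟨c, hc⟩ := hu
  obtain ⟨d, hd⟩ := hv
  refine ⟨c + d, ?_⟩
  filter_upwards [hc, hd] with j h1 h2 x
  rw [Pi.mul_apply, abs_mul, pow_add]
  exact mul_le_mul (h1 x) (h2 x) (abs_nonneg _) ((abs_nonneg _).trans (h1 x))

theorem Moderate.const (hQ : Tendsto Q atTop atTop) (C : ℝ) (hu : ∀ᶠ j in atTop, ∀ x, |u j x| ≤ C) :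
    Moderate Q u := by
  refine ⟨1, ?_⟩
  filter_upwards [hQ.eventually_ge_atTop C, hu] with j h1 h2 x
  rw [pow_one]
  exact (h2 x).trans h1

theorem Moderate.add (hQ : Tendsto Q atTop atTop) (hu : Moderate Q u) (hv : Moderate Q v) :
    Moderate Q fun j => u j + v j := by
  obtain ⟨c, hc⟩ := hu
  obtain ⟨d, hd⟩ := hv
  refine ⟨c + d + 1, ?_⟩
  filter_upwards [hc, hd, hQ.eventually_ge_atTop 2] with j h1 h2 h3 x
  have e1 : Q j ^ c ≤ Q j ^ (c + d) := pow_le_pow_right₀ (by linarith) (by omega)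
  have e2 : Q j ^ d ≤ Q j ^ (c + d) := pow_le_pow_right₀ (by linarith) (by omega)
  have e3 : 0 ≤ Q j ^ (c + d) := by positivity
  calc |u j x + v j x| ≤ |u j x| + |v j x| := abs_add_le _ _
    _ ≤ Q j ^ (c + d) * 2 := by linarith [h1 x, h2 x]
    _ ≤ Q j ^ (c + d + 1) := by rw [pow_succ]; gcongr

theorem ModerateUpTo.mono {k l : ℕ} (h : ModerateUpTo Q l u) (hkl : k ≤ l) : ModerateUpTo Q k u :=
  fun i hi => h i (hi.trans hkl)

theorem ModerateUpTo.succ_of_deriv {k : ℕ} (h0 : Moderate Q u)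
    (h : ModerateUpTo Q k fun j => deriv (u j)) : ModerateUpTo Q (k + 1) u := by
  intro i hi
  cases i with
  | zero => simpa using h0
  | succ i =>
    simp only [iteratedDeriv_succ']
    exact h i (by omega)

theorem ModerateUpTo.deriv {k : ℕ} (h : ModerateUpTo Q (k + 1) u) :
    ModerateUpTo Q k fun j => deriv (u j) := by
  intro i hi
  simp only [← iteratedDeriv_succ']
  exact h (i + 1) (by omega)

theorem ModerateUpTo.moderate {k : ℕ} (h : ModerateUpTo Q k u) : Moderate Q u := by
  simpa using h 0 k.zero_le

theorem ModerateUpTo.add (hQ : Tendsto Q atTop atTop) (su : ∀ j, ContDiff ℝ ∞ (u j))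
    (sv : ∀ j, ContDiff ℝ ∞ (v j)) {k : ℕ} (hu : ModerateUpTo Q k u) (hv : ModerateUpTo Q k v) :
    ModerateUpTo Q k fun j => u j + v j := by
  intro i hi
  have : ∀ j, iteratedDeriv i (u j + v j) = iteratedDeriv i (u j) + iteratedDeriv i (v j) :=
    fun j => funext fun x => iteratedDeriv_add ((su j).of_le (by exact_mod_cast le_top)).contDiffAt
      ((sv j).of_le (by exact_mod_cast le_top)).contDiffAt
  simp only [this]
  exact (hu i hi).add hQ (hv i hi)

theorem ModerateUpTo.mul (hQ : Tendsto Q atTop atTop) {k : ℕ} :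
    ∀ {u v : ℕ → ℝ → ℝ}, (∀ j, ContDiff ℝ ∞ (u j)) → (∀ j, ContDiff ℝ ∞ (v j)) →
      ModerateUpTo Q k u → ModerateUpTo Q k v → ModerateUpTo Q k fun j => u j * v j := by
  induction k with
  | zero =>
    intro u v _ _ hu hv i hi
    obtain rfl : i = 0 := by omega
    simpa using hu.moderate.mul hv.moderate
  | succ k ih =>
    intro u v su sv hu hv
    refine .succ_of_deriv (hu.moderate.mul hv.moderate) ?_
    have : ∀ j, _root_.deriv (u j * v j) = _root_.deriv (u j) * v j + u j * _root_.deriv (v j) :=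
      fun j => funext fun x =>
        deriv_mul (differentiable_of_contDiff (su j) x) (differentiable_of_contDiff (sv j) x)
    simp only [this]
    have su' := fun j => contDiff_deriv_of_contDiff (su j)
    have sv' := fun j => contDiff_deriv_of_contDiff (sv j)
    exact .add hQ (fun j => (su' j).mul (sv j)) (fun j => (su j).mul (sv' j))
      (ih su' sv hu.deriv (hv.mono k.le_succ)) (ih su sv' (hu.mono k.le_succ) hv.deriv)

theorem ModerateUpTo.comp (hQ : Tendsto Q atTop atTop) {k : ℕ} :
    ∀ {u w : ℕ → ℝ → ℝ}, (∀ j, ContDiff ℝ ∞ (u j)) → (∀ j, ContDiff ℝ ∞ (w j)) →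
      ModerateUpTo Q k u → (SmoothModerate Q fun j => _root_.deriv (w j)) →
      ModerateUpTo Q k fun j => u j ∘ w j := by
  induction k with
  | zero =>
    intro u w _ _ hu hw i hi
    obtain rfl : i = 0 := by omega
    simpa [Function.comp_def] using hu.moderate.comp_right w
  | succ k ih =>
    intro u w su sw hu hw
    refine .succ_of_deriv (hu.moderate.comp_right w) ?_
    have : ∀ j, _root_.deriv (u j ∘ w j) = (_root_.deriv (u j) ∘ w j) * _root_.deriv (w j) :=
      fun j => funext fun x =>
        deriv_comp x (differentiable_of_contDiff (su j) _) (differentiable_of_contDiff (sw j) x)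
    simp only [this]
    have su' := fun j => contDiff_deriv_of_contDiff (su j)
    exact .mul hQ (fun j => (su' j).comp (sw j)) hw.contDiff (ih su' sw hu.deriv hw)
      fun i _ => hw.moderate i

theorem ModerateUpTo.inv (hQ : Tendsto Q atTop atTop) {k : ℕ} (su : ∀ j, ContDiff ℝ ∞ (u j))
    (hne : ∀ j x, u j x ≠ 0) (hi : Moderate Q fun j => (u j)⁻¹) (hu : ModerateUpTo Q k u) :
    ModerateUpTo Q k fun j => (u j)⁻¹ := by
  induction k with
  | zero =>
    intro i h
    obtain rfl : i = 0 := by omega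
    simpa using hi
  | succ k ih =>
    refine .succ_of_deriv hi ?_
    have : ∀ j, _root_.deriv (u j)⁻¹ = (-_root_.deriv (u j)) * ((u j)⁻¹ * (u j)⁻¹) := by
      refine fun j => funext fun x => ?_
      rw [deriv_inv'' (differentiable_of_contDiff (su j) x) (hne j x)]
      simp only [Pi.mul_apply, Pi.neg_apply, Pi.inv_apply]
      field_simp
    simp only [this]
    have si : ∀ j, ContDiff ℝ ∞ (u j)⁻¹ := fun j => (su j).inv (hne j)
    have h1 := ih (hu.mono k.le_succ)
    refine .mul hQ (fun j => (contDiff_deriv_of_contDiff (su j)).neg)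
      (fun j => (si j).mul (si j)) (fun i hk => ?_) (.mul hQ si si h1 h1)
    obtain ⟨c, hc⟩ := hu.deriv i hk
    refine ⟨c, ?_⟩
    filter_upwards [hc] with j hj x
    have e : iteratedDeriv i (-_root_.deriv (u j)) x = -iteratedDeriv i (_root_.deriv (u j)) x :=
      iteratedDeriv_neg i (_root_.deriv (u j)) x
    rw [e, abs_neg]
    exact hj x

theorem SmoothModerate.upTo (hu : SmoothModerate Q u) (k : ℕ) : ModerateUpTo Q k u :=
  fun i _ => hu.moderate i

theorem SmoothModerate.add (hQ : Tendsto Q atTop atTop) (hu : SmoothModerate Q u)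
    (hv : SmoothModerate Q v) : SmoothModerate Q fun j => u j + v j :=
  ⟨fun j => (hu.contDiff j).add (hv.contDiff j), fun k =>
    ModerateUpTo.add hQ hu.contDiff hv.contDiff (hu.upTo k) (hv.upTo k) k le_rfl⟩

theorem SmoothModerate.mul (hQ : Tendsto Q atTop atTop) (hu : SmoothModerate Q u)
    (hv : SmoothModerate Q v) : SmoothModerate Q fun j => u j * v j :=
  ⟨fun j => (hu.contDiff j).mul (hv.contDiff j), fun k =>
    ModerateUpTo.mul hQ hu.contDiff hv.contDiff (hu.upTo k) (hv.upTo k) k le_rfl⟩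

theorem SmoothModerate.inv (hQ : Tendsto Q atTop atTop) (hu : SmoothModerate Q u)
    (hne : ∀ j x, u j x ≠ 0) (hi : Moderate Q fun j => (u j)⁻¹) :
    SmoothModerate Q fun j => (u j)⁻¹ :=
  ⟨fun j => (hu.contDiff j).inv (hne j), fun k =>
    ModerateUpTo.inv hQ hu.contDiff hne hi (hu.upTo k) k le_rfl⟩

theorem SmoothModerate.comp (hQ : Tendsto Q atTop atTop) (hu : SmoothModerate Q u)
    (sw : ∀ j, ContDiff ℝ ∞ (w j)) (hw : SmoothModerate Q fun j => deriv (w j)) :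
    SmoothModerate Q fun j => u j ∘ w j :=
  ⟨fun j => (hu.contDiff j).comp (sw j), fun k =>
    ModerateUpTo.comp hQ hu.contDiff sw (hu.upTo k) hw k le_rfl⟩

theorem SmoothModerate.deriv (hu : SmoothModerate Q u) : SmoothModerate Q fun j => deriv (u j) :=
  ⟨fun j => contDiff_deriv_of_contDiff (hu.contDiff j), fun k => by
    simpa only [← iteratedDeriv_succ'] using hu.moderate (k + 1)⟩

/-- A moderate sequence of constants. -/
theorem SmoothModerate.constants (hQ : Tendsto Q atTop atTop) {c : ℕ → ℝ} {m : ℕ}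
    (h : ∀ᶠ j in atTop, |c j| ≤ Q j ^ m) : SmoothModerate Q fun j _ => c j := by
  refine ⟨fun j => contDiff_const, fun k => ?_⟩
  cases k with
  | zero => exact ⟨m, by filter_upwards [h] with j hj x using by simpa using hj⟩
  | succ k => exact .const hQ 0 (.of_forall fun j x => by simp [iteratedDeriv_const])

/-- A fixed smooth function with bounded derivatives. -/
theorem SmoothModerate.of_bounded (hQ : Tendsto Q atTop atTop) {f : ℝ → ℝ} (sf : ContDiff ℝ ∞ f)
    (hf : ∀ k, ∃ C, ∀ x, |iteratedDeriv k f x| ≤ C) : SmoothModerate Q fun _ => f :=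
  ⟨fun _ => sf, fun k => by
    obtain ⟨C, hC⟩ := hf k
    exact .const hQ C (.of_forall fun _ x => hC x)⟩

theorem Negligible.tendsto (hQ : Tendsto Q atTop atTop) (hu : Negligible Q u) {ε : ℝ}
    (hε : 0 < ε) : ∀ᶠ j in atTop, ∀ x, |u j x| ≤ ε := by
  filter_upwards [hu 1, hQ.eventually_ge_atTop ε⁻¹] with j h1 h2 x
  refine (h1 x).trans ?_
  rw [pow_one]
  exact inv_le_of_inv_le₀ hε h2

/-- Interpolation: negligible functions with moderate second derivative have negligible
derivative. -/
theorem Negligible.deriv (hQ : Tendsto Q atTop atTop) (su : ∀ j, ContDiff ℝ ∞ (u j))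
    (hu : Negligible Q u) (h2 : Moderate Q fun j => deriv (deriv (u j))) :
    Negligible Q fun j => deriv (u j) := by
  intro m
  obtain ⟨c, hc⟩ := h2
  filter_upwards [hc, hu (c + 2 * (m + 1) + 1), hQ.eventually_ge_atTop 4] with j hc hu hQ x
  have hQ0 : 0 < Q j := by linarith
  set s := (Q j ^ (c + (m + 1)))⁻¹ with hs
  have hs0 : 0 < s := by positivity
  have hd := differentiable_of_contDiff (su j)
  have hd' := differentiable_of_contDiff (contDiff_deriv_of_contDiff (su j))
  obtain ⟨ξ, hξ, e⟩ := exists_deriv_eq_slope (u j) (show x < x + s by linarith)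
    hd.continuous.continuousOn hd.differentiableOn
  have e1 : |_root_.deriv (u j) x - _root_.deriv (u j) ξ| ≤ Q j ^ c * |x - ξ| :=
    Convex.norm_image_sub_le_of_norm_deriv_le (s := Set.univ) (fun y _ => hd' y)
      (fun y _ => hc y) convex_univ trivial trivial
  have e2 : |x - ξ| ≤ s := by
    rw [abs_le]
    constructor <;> linarith [hξ.1, hξ.2]
  have e3 : |_root_.deriv (u j) ξ| ≤ 2 * (Q j ^ (c + 2 * (m + 1) + 1))⁻¹ / s := by
    rw [e, add_sub_cancel_left, abs_div, abs_of_pos hs0]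
    gcongr
    calc |u j (x + s) - u j x| ≤ |u j (x + s)| + |u j x| := abs_sub _ _
      _ ≤ _ := by linarith [hu x, hu (x + s)]
  have e4 : Q j ^ c * s = (Q j ^ (m + 1))⁻¹ := by
    rw [hs, pow_add]
    field_simp
  have e5 : 2 * (Q j ^ (c + 2 * (m + 1) + 1))⁻¹ / s ≤ (Q j ^ (m + 1))⁻¹ := by
    have : 2 * (Q j ^ (c + 2 * (m + 1) + 1))⁻¹ / s = 2 * (Q j)⁻¹ * (Q j ^ (m + 1))⁻¹ := by
      rw [hs]
      field_simp
      ring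
    rw [this]
    have : 2 * (Q j)⁻¹ ≤ 1 := by
      rw [← div_eq_mul_inv, div_le_one hQ0]
      linarith
    exact mul_le_of_le_one_left (by positivity) this
  calc |_root_.deriv (u j) x|
      ≤ |_root_.deriv (u j) x - _root_.deriv (u j) ξ| + |_root_.deriv (u j) ξ| := by
        simpa using abs_add_le (_root_.deriv (u j) x - _root_.deriv (u j) ξ) (_root_.deriv (u j) ξ)
    _ ≤ (Q j ^ (m + 1))⁻¹ + (Q j ^ (m + 1))⁻¹ := by
        refine add_le_add (e1.trans ?_) (e3.trans e5)
        rw [← e4]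
        gcongr
    _ = 2 * (Q j)⁻¹ * (Q j ^ m)⁻¹ := by
        rw [pow_succ]
        field_simp
        ring
    _ ≤ (Q j ^ m)⁻¹ := by
        have : 2 * (Q j)⁻¹ ≤ 1 := by
          rw [← div_eq_mul_inv, div_le_one hQ0]
          linarith
        exact mul_le_of_le_one_left (by positivity) this

theorem Negligible.iteratedDeriv (hQ : Tendsto Q atTop atTop) (su : ∀ j, ContDiff ℝ ∞ (u j))
    (hu : Negligible Q u) (h : SmoothModerate Q fun j => _root_.deriv (u j)) (k : ℕ) :
    Negligible Q fun j => iteratedDeriv k (u j) := by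
  induction k generalizing u with
  | zero => simpa using hu
  | succ k ih =>
    simp only [iteratedDeriv_succ']
    exact ih h.contDiff (hu.deriv hQ su (by simpa using h.moderate 1)) h.deriv

end

theorem exists_bound_iteratedDeriv_of_periodic {f : ℝ → ℝ} {c : ℝ} (hc : c ≠ 0)
    (hf : Function.Periodic f c) (sf : ContDiff ℝ ∞ f) (k : ℕ) :
    ∃ C, ∀ x, |iteratedDeriv k f x| ≤ C := by
  have hper : Function.Periodic (iteratedDeriv k f) c := fun x => by
    have h := congrFun (iteratedDeriv_comp_add_const k f c) x
    rw [← h]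
    congr 1
    exact funext hf
  obtain ⟨C, hC⟩ := (hper.isBounded_of_continuous hc
    (sf.continuous_iteratedDeriv k (by exact_mod_cast le_top))).exists_norm_le
  exact ⟨C, fun x => hC _ ⟨x, rfl⟩⟩

theorem periodic_deriv_lift (F : CircleDeg1Lift) : Function.Periodic (deriv F) 1 := fun y => by
  rw [← deriv_comp_add_const]
  have : (fun z => F (z + 1)) = fun z => F z + 1 := funext fun z => F.map_add_one z
  rw [this, deriv_add_const]

/-- Lifts of orientation-preserving smooth circle diffeomorphisms. -/
structure SmoothLift (u : CircleDeg1Liftˣ) : Prop where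
  contDiff : ContDiff ℝ ∞ u
  contDiff_inv : ContDiff ℝ ∞ (u⁻¹ : CircleDeg1Liftˣ)

namespace SmoothLift

theorem one : SmoothLift 1 := by
  refine ⟨contDiff_id, ?_⟩
  rw [inv_one]
  exact contDiff_id

theorem mul {u v : CircleDeg1Liftˣ} (hu : SmoothLift u) (hv : SmoothLift v) :
    SmoothLift (u * v) := by
  refine ⟨hu.contDiff.comp hv.contDiff, ?_⟩
  rw [mul_inv_rev]
  exact hv.contDiff_inv.comp hu.contDiff_inv

theorem inv {u : CircleDeg1Liftˣ} (hu : SmoothLift u) : SmoothLift u⁻¹ :=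
  ⟨hu.contDiff_inv, by rw [inv_inv]; exact hu.contDiff⟩

end SmoothLift

theorem contDiff_translate (t : ℝ) :
    ContDiff ℝ ∞ (CircleDeg1Lift.translate (Multiplicative.ofAdd t)) := by
  have : ⇑(CircleDeg1Lift.translate (Multiplicative.ofAdd t) : CircleDeg1Lift) = fun x => t + x :=
    funext fun x => CircleDeg1Lift.translate_apply t x
  rw [this]
  fun_prop

theorem exists_lipschitz_of_contDiff {F : CircleDeg1Lift} (hF : ContDiff ℝ ∞ F) :
    ∃ L, 0 < L ∧ ∀ x y, |F x - F y| ≤ L * |x - y| := by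
  obtain ⟨C, hC⟩ := exists_bound_iteratedDeriv_of_periodic one_ne_zero (periodic_deriv_lift F)
    (contDiff_deriv_of_contDiff hF) 0
  refine ⟨max C 1, by positivity, fun x y => ?_⟩
  exact Convex.norm_image_sub_le_of_norm_deriv_le (s := Set.univ)
    (fun y _ => differentiable_of_contDiff hF y)
    (fun y _ => (by simpa using hC y : |deriv F y| ≤ C).trans (le_max_left _ _)) convex_univ
    trivial trivial

/-- Families of smooth functions with moderate derivatives. -/
structure ModerateLift (Q : ℕ → ℝ) (u : ℕ → ℝ → ℝ) : Prop where
  contDiff : ∀ j, ContDiff ℝ ∞ (u j)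
  deriv : SmoothModerate Q fun j => deriv (u j)

namespace ModerateLift

variable {Q : ℕ → ℝ} {u v : ℕ → ℝ → ℝ}

theorem comp (hQ : Tendsto Q atTop atTop) (hu : ModerateLift Q u) (hv : ModerateLift Q v) :
    ModerateLift Q fun j => u j ∘ v j := by
  refine ⟨fun j => (hu.contDiff j).comp (hv.contDiff j), ?_⟩
  have : ∀ j, _root_.deriv (u j ∘ v j) = (_root_.deriv (u j) ∘ v j) * _root_.deriv (v j) :=
    fun j => funext fun x => deriv_comp x (differentiable_of_contDiff (hu.contDiff j) _)
      (differentiable_of_contDiff (hv.contDiff j) x)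
  simp only [this]
  exact (hu.deriv.comp hQ hv.contDiff hv.deriv).mul hQ hv.deriv

theorem of_lift (hQ : Tendsto Q atTop atTop) {F : CircleDeg1Lift} (hF : ContDiff ℝ ∞ F) :
    ModerateLift Q fun _ => F :=
  ⟨fun _ => hF, .of_bounded hQ (contDiff_deriv_of_contDiff hF)
    (exists_bound_iteratedDeriv_of_periodic one_ne_zero (periodic_deriv_lift F)
      (contDiff_deriv_of_contDiff hF))⟩

theorem sub (hQ : Tendsto Q atTop atTop) (hu : ModerateLift Q u) (hv : ModerateLift Q v) :
    ModerateLift Q fun j => u j - v j := by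
  refine ⟨fun j => (hu.contDiff j).sub (hv.contDiff j), ?_⟩
  have : ∀ j, _root_.deriv (u j - v j)
      = _root_.deriv (u j) + (fun _ => -1 : ℝ → ℝ) * _root_.deriv (v j) :=
    fun j => funext fun x => by
      rw [deriv_sub (differentiable_of_contDiff (hu.contDiff j) x)
        (differentiable_of_contDiff (hv.contDiff j) x)]
      simp [sub_eq_add_neg]
  simp only [this]
  refine hu.deriv.add hQ ((SmoothModerate.constants hQ (c := fun _ => -1) (m := 1) ?_).mul hQ
    hv.deriv)
  filter_upwards [hQ.eventually_ge_atTop 1] with j hj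
  simpa using hj

end ModerateLift

/-- The lift of the Möbius transformation `z ↦ (z - r) / (1 - r z)` of the unit circle, conjugated
by the `q`-fold covering. -/
def blaschke (q : ℕ) (r x : ℝ) : ℝ :=
  x + Real.arctan (r * Real.sin (2 * Real.pi * q * x) *
    (1 - r * Real.cos (2 * Real.pi * q * x))⁻¹) / (Real.pi * q)

section blaschke

variable {q : ℕ} {r : ℝ}

theorem one_sub_mul_cos_pos (hr : |r| < 1) (θ : ℝ) : 0 < 1 - r * Real.cos θ := by
  have : |r * Real.cos θ| < 1 := by
    rw [abs_mul]
    exact (mul_le_of_le_one_right (abs_nonneg _) (Real.abs_cos_le_one θ)).trans_lt hr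
  linarith [(abs_lt.1 this).2]

theorem sin_cos_add_two_arctan (hr : |r| < 1) (θ : ℝ) :
    Real.sin (θ + 2 * Real.arctan (r * Real.sin θ * (1 - r * Real.cos θ)⁻¹)) =
        (1 - r ^ 2) * Real.sin θ / (1 - 2 * r * Real.cos θ + r ^ 2) ∧
      Real.cos (θ + 2 * Real.arctan (r * Real.sin θ * (1 - r * Real.cos θ)⁻¹)) =
        ((1 + r ^ 2) * Real.cos θ - 2 * r) / (1 - 2 * r * Real.cos θ + r ^ 2) ∧
      0 < 1 - 2 * r * Real.cos θ + r ^ 2 := by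
  have hd := one_sub_mul_cos_pos hr θ
  set s := Real.sin θ with hsd
  set c := Real.cos θ with hcd
  have hsc : s ^ 2 = 1 - c ^ 2 := by rw [← Real.sin_sq_add_cos_sq θ]; ring
  set T := r * s * (1 - r * c)⁻¹ with hT
  have hT' : T * (1 - r * c) = r * s := by rw [hT]; field_simp
  have hN : 0 < 1 - 2 * r * c + r ^ 2 := by
    have : 1 - 2 * r * c + r ^ 2 = (1 - r * c) ^ 2 + (r * s) ^ 2 := by
      rw [mul_pow, hsc]; ring
    rw [this]
    positivity
  have hNT : (1 + T ^ 2) * (1 - r * c) ^ 2 = 1 - 2 * r * c + r ^ 2 := by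
    have : (1 + T ^ 2) * (1 - r * c) ^ 2 = (1 - r * c) ^ 2 + (T * (1 - r * c)) ^ 2 := by ring
    rw [this, hT', mul_pow, hsc]
    ring
  have hTp : 0 < 1 + T ^ 2 := by positivity
  have hc2 : Real.cos (2 * Real.arctan T) = (1 - T ^ 2) / (1 + T ^ 2) := by
    rw [Real.cos_two_mul, Real.cos_sq_arctan]
    field_simp
    ring
  have hs2 : Real.sin (2 * Real.arctan T) = 2 * T / (1 + T ^ 2) := by
    have h1 : Real.sin (Real.arctan T) = T * Real.cos (Real.arctan T) := by
      conv_lhs => rw [← Real.tan_mul_cos (Real.cos_arctan_pos T).ne', Real.tan_arctan]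
    rw [Real.sin_two_mul, h1]
    have : 2 * (T * Real.cos (Real.arctan T)) * Real.cos (Real.arctan T)
      = 2 * T * Real.cos (Real.arctan T) ^ 2 := by ring
    rw [this, Real.cos_sq_arctan]
    ring
  have hc3 : Real.cos (2 * Real.arctan T) * (1 - 2 * r * c + r ^ 2)
      = (1 - r * c) ^ 2 - (r * s) ^ 2 := by
    rw [hc2, ← hNT, ← hT']
    field_simp
  have hs3 : Real.sin (2 * Real.arctan T) * (1 - 2 * r * c + r ^ 2)
      = 2 * (r * s) * (1 - r * c) := by
    rw [hs2, ← hNT, ← hT']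
    field_simp
  refine ⟨?_, ?_, hN⟩
  · rw [Real.sin_add, eq_div_iff hN.ne', ← hsd, ← hcd]
    linear_combination s * hc3 + c * hs3 - s * r ^ 2 * hsc
  · rw [Real.cos_add, eq_div_iff hN.ne', ← hsd, ← hcd]
    linear_combination c * hc3 - s * hs3 + (r ^ 2 * c - 2 * r) * hsc

theorem blaschke_neg_blaschke (hq : 0 < q) (hr : |r| < 1) (x : ℝ) :
    blaschke q (-r) (blaschke q r x) = x := by
  have hq' : (0 : ℝ) < q := by exact_mod_cast hq
  have hπ := Real.pi_pos
  set θ := 2 * Real.pi * q * x with hθ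
  set T := r * Real.sin θ * (1 - r * Real.cos θ)⁻¹ with hT
  have e : 2 * Real.pi * q * blaschke q r x = θ + 2 * Real.arctan T := by
    rw [blaschke, ← hθ, ← hT, mul_add, ← hθ]
    field_simp
  obtain ⟨hs, hc, hN⟩ := sin_cos_add_two_arctan hr θ
  rw [← hT] at hs hc
  have hd := one_sub_mul_cos_pos hr θ
  have hr2 : 0 < 1 - r ^ 2 := by
    rw [← sq_abs]
    nlinarith [abs_nonneg r]
  have e2 : -r * Real.sin (θ + 2 * Real.arctan T) *
      (1 - -r * Real.cos (θ + 2 * Real.arctan T))⁻¹ = -T := by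
    rw [hs, hc, hT]
    generalize hNd : 1 - 2 * r * Real.cos θ + r ^ 2 = N at hN ⊢
    have e3 : 1 - -r * (((1 + r ^ 2) * Real.cos θ - 2 * r) / N)
      = (1 - r ^ 2) * (1 - r * Real.cos θ) / N := by
      rw [eq_div_iff hN.ne']
      linear_combination r * div_mul_cancel₀ ((1 + r ^ 2) * Real.cos θ - 2 * r) hN.ne' - hNd
    rw [e3]
    field_simp
  rw [blaschke, e, e2, Real.arctan_neg, blaschke, ← hθ, ← hT]
  ring

theorem contDiff_blaschke (hr : |r| < 1) : ContDiff ℝ ∞ (blaschke q r) := by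
  have : ∀ x, 1 - r * Real.cos (2 * Real.pi * q * x) ≠ 0 := fun x =>
    (one_sub_mul_cos_pos hr _).ne'
  have h1 : ContDiff ℝ ∞ fun x : ℝ => r * Real.sin (2 * Real.pi * q * x) *
    (1 - r * Real.cos (2 * Real.pi * q * x))⁻¹ :=
    ContDiff.mul (by fun_prop) (ContDiff.inv (by fun_prop) this)
  exact contDiff_id.add (h1.arctan.div_const _)

theorem blaschke_add_div (hq : 0 < q) (p : ℤ) (x : ℝ) :
    blaschke q r (x + p / q) = blaschke q r x + p / q := by
  have hq' : (q : ℝ) ≠ 0 := by exact_mod_cast hq.ne'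
  have e : 2 * Real.pi * q * (x + p / q) = 2 * Real.pi * q * x + p * (2 * Real.pi) := by
    field_simp
  rw [blaschke, e, Real.sin_add_int_mul_two_pi, Real.cos_add_int_mul_two_pi, blaschke]
  ring

theorem blaschke_add_one (hq : 0 < q) (x : ℝ) : blaschke q r (x + 1) = blaschke q r x + 1 := by
  have hq' : (q : ℝ) ≠ 0 := by exact_mod_cast hq.ne'
  simpa [hq'] using blaschke_add_div (r := r) hq q x

theorem blaschke_strictMono (hq : 0 < q) (hr : |r| < 1) : StrictMono (blaschke q r) := by
  have hinj : Function.Injective (blaschke q r) :=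
    Function.LeftInverse.injective (blaschke_neg_blaschke hq hr)
  refine ((contDiff_blaschke hr).continuous.strictMono_of_inj hinj).resolve_right fun h => ?_
  have := h (show (0 : ℝ) < 0 + 1 by norm_num)
  rw [blaschke_add_one hq] at this
  linarith

theorem abs_blaschke_sub_le (q : ℕ) (r x : ℝ) : |blaschke q r x - x| ≤ (q : ℝ)⁻¹ := by
  have hπ := Real.pi_pos
  rw [blaschke, add_sub_cancel_left, abs_div, abs_of_nonneg (by positivity : 0 ≤ Real.pi * q)]
  set A := Real.arctan (r * Real.sin (2 * Real.pi * q * x) *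
    (1 - r * Real.cos (2 * Real.pi * q * x))⁻¹)
  have : |A| ≤ Real.pi := by
    rw [abs_le]
    constructor <;> linarith [Real.arctan_lt_pi_div_two (r * Real.sin (2 * Real.pi * q * x) *
      (1 - r * Real.cos (2 * Real.pi * q * x))⁻¹), Real.neg_pi_div_two_lt_arctan
      (r * Real.sin (2 * Real.pi * q * x) * (1 - r * Real.cos (2 * Real.pi * q * x))⁻¹)]
  calc |A| / (Real.pi * q) ≤ Real.pi / (Real.pi * q) := by gcongr
    _ = (q : ℝ)⁻¹ := by field_simp

theorem blaschke_zero : blaschke q r 0 = 0 := by simp [blaschke]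

theorem blaschke_half (hq : 0 < q) : blaschke q r (1 / (2 * q)) = 1 / (2 * q) := by
  have hq' : (q : ℝ) ≠ 0 := by exact_mod_cast hq.ne'
  have e : 2 * Real.pi * q * (1 / (2 * q)) = Real.pi := by field_simp
  rw [blaschke, e]
  simp

theorem blaschke_quarter (hq : 0 < q) :
    blaschke q r (1 / (4 * q)) = 1 / (4 * q) + Real.arctan r / (Real.pi * q) := by
  have hq' : (q : ℝ) ≠ 0 := by exact_mod_cast hq.ne'
  have e : 2 * Real.pi * q * (1 / (4 * q)) = Real.pi / 2 := by field_simp; norm_num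
  rw [blaschke, e]
  simp

theorem abs_quarter_sub_arctan_le (hq : 0 < q) (hr : |r| < 1) :
    |1 / (4 * q) - Real.arctan r / (Real.pi * q)| ≤ 1 - r := by
  have hq' : (1 : ℝ) ≤ q := by exact_mod_cast hq
  have hπ := Real.pi_gt_three
  have e : 1 / (4 * q) - Real.arctan r / (Real.pi * q)
      = (Real.arctan 1 - Real.arctan r) / (Real.pi * q) := by
    rw [Real.arctan_one]
    field_simp
  have h1 : |Real.arctan 1 - Real.arctan r| ≤ 1 * |1 - r| := by
    refine Convex.norm_image_sub_le_of_norm_deriv_le (s := Set.univ) (f := Real.arctan)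
      (fun y _ => Real.differentiable_arctan y) (fun y _ => ?_) convex_univ trivial trivial
    rw [Real.deriv_arctan, Real.norm_eq_abs, abs_of_nonneg (by positivity)]
    rw [div_le_one (by positivity)]
    nlinarith [sq_nonneg y]
  rw [one_mul, abs_of_nonneg (by linarith [(abs_lt.1 hr).2] : (0 : ℝ) ≤ 1 - r)] at h1
  rw [e, abs_div, abs_of_nonneg (by positivity : 0 ≤ Real.pi * q)]
  refine (div_le_self (abs_nonneg _) ?_).trans h1
  nlinarith

/-- The unit of `CircleDeg1Lift` given by `blaschke q r`. -/
def blaschkeUnit (q : ℕ) (r : ℝ) (hq : 0 < q) (hr : |r| < 1) : CircleDeg1Liftˣ where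
  val := ⟨⟨blaschke q r, (blaschke_strictMono hq hr).monotone⟩, blaschke_add_one hq⟩
  inv := ⟨⟨blaschke q (-r), (blaschke_strictMono hq (by rwa [abs_neg])).monotone⟩,
    blaschke_add_one hq⟩
  val_inv := CircleDeg1Lift.ext fun x => by
    simpa using blaschke_neg_blaschke (r := -r) hq (by rwa [abs_neg]) x
  inv_val := CircleDeg1Lift.ext fun x => blaschke_neg_blaschke hq hr x

theorem coe_blaschkeUnit (hq : 0 < q) (hr : |r| < 1) : ⇑(blaschkeUnit q r hq hr) = blaschke q r :=
  rfl

theorem coe_blaschkeUnit_inv (hq : 0 < q) (hr : |r| < 1) :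
    ⇑((blaschkeUnit q r hq hr)⁻¹ : CircleDeg1Liftˣ) = blaschke q (-r) :=
  rfl

theorem smoothLift_blaschkeUnit (hq : 0 < q) (hr : |r| < 1) :
    SmoothLift (blaschkeUnit q r hq hr) :=
  ⟨contDiff_blaschke hr, contDiff_blaschke (by rwa [abs_neg])⟩

end blaschke

/-- The maps `blaschke (q j) (r j)` are moderate as long as `q j` and `1 / (1 - |r j|)` are. -/
theorem moderateLift_blaschke {Q : ℕ → ℝ} (hQ : Tendsto Q atTop atTop) {q : ℕ → ℕ} {r : ℕ → ℝ}
    (hq : ∀ j, 0 < q j) (hr : ∀ j, |r j| < 1) (hqQ : ∀ j, (q j : ℝ) ≤ Q j)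
    (hrQ : ∀ j, (1 - |r j|)⁻¹ ≤ Q j) : ModerateLift Q fun j => blaschke (q j) (r j) := by
  refine ⟨fun j => contDiff_blaschke (hr j), ?_⟩
  have hπ := Real.pi_pos
  let ℓ : ℕ → ℝ → ℝ := fun j x => 2 * Real.pi * q j * x
  have sℓ : ∀ j, ContDiff ℝ ∞ (ℓ j) := fun j => by fun_prop
  have cm : SmoothModerate Q fun j _ => 2 * Real.pi * q j := by
    refine .constants hQ (m := 2) ?_
    filter_upwards [hQ.eventually_ge_atTop (2 * Real.pi)] with j hj
    rw [abs_of_nonneg (by positivity), sq]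
    exact mul_le_mul hj (hqQ j) (by positivity) (by linarith)
  have dℓ : SmoothModerate Q fun j => deriv (ℓ j) := by
    have : ∀ j, deriv (ℓ j) = fun _ => 2 * Real.pi * q j := fun j => funext fun x => by
      simp [ℓ]
    simpa only [this] using cm
  have ms : SmoothModerate Q fun j => Real.sin ∘ ℓ j :=
    SmoothModerate.comp hQ (.of_bounded hQ Real.contDiff_sin
      (exists_bound_iteratedDeriv_of_periodic Real.two_pi_pos.ne' Real.sin_periodic
        Real.contDiff_sin)) sℓ dℓ
  have mc : SmoothModerate Q fun j => Real.cos ∘ ℓ j :=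
    SmoothModerate.comp hQ (.of_bounded hQ Real.contDiff_cos
      (exists_bound_iteratedDeriv_of_periodic Real.two_pi_pos.ne' Real.cos_periodic
        Real.contDiff_cos)) sℓ dℓ
  have mr : ∀ ε : ℝ, |ε| = 1 → SmoothModerate Q fun j _ => ε * r j := fun ε hε => by
    refine .constants hQ (m := 1) ?_
    filter_upwards [hQ.eventually_ge_atTop 1] with j hj
    rw [pow_one, abs_mul, hε, one_mul]
    exact (hr j).le.trans hj
  have m1 : SmoothModerate Q fun _ _ => 1 := by
    refine .constants hQ (m := 1) ?_
    filter_upwards [hQ.eventually_ge_atTop 1] with j hj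
    simpa using hj
  let d : ℕ → ℝ → ℝ := fun j => (fun _ => 1) + (fun _ => -1 * r j) * (Real.cos ∘ ℓ j)
  have hd : ∀ j x, d j x = 1 - r j * Real.cos (ℓ j x) := fun j x => by
    simp only [d, Pi.add_apply, Pi.mul_apply, Function.comp_apply]
    ring
  have md : SmoothModerate Q d := m1.add hQ ((mr (-1) (by simp)).mul hQ mc)
  have hdp : ∀ j x, 0 < d j x := fun j x => by
    rw [hd]
    exact one_sub_mul_cos_pos (hr j) _
  have mdi : SmoothModerate Q fun j => (d j)⁻¹ := by
    refine md.inv hQ (fun j x => (hdp j x).ne') ⟨1, .of_forall fun j x => ?_⟩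
    change |(d j x)⁻¹| ≤ _
    rw [pow_one, abs_of_nonneg (inv_nonneg.2 (hdp j x).le)]
    refine le_trans (inv_anti₀ (by linarith [hr j]) ?_) (hrQ j)
    rw [hd]
    have h1 : |r j * Real.cos (ℓ j x)| ≤ |r j| := by
      rw [abs_mul]
      exact mul_le_of_le_one_right (abs_nonneg _) (Real.abs_cos_le_one _)
    linarith [le_abs_self (r j * Real.cos (ℓ j x))]
  let T : ℕ → ℝ → ℝ := fun j => (fun _ => 1 * r j) * (Real.sin ∘ ℓ j) * (d j)⁻¹
  have mT : SmoothModerate Q T := ((mr 1 (by simp)).mul hQ ms).mul hQ mdi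
  let e : ℕ → ℝ → ℝ := fun j => (fun _ => 1) + T j * T j
  have me : SmoothModerate Q e := m1.add hQ (mT.mul hQ mT)
  have he : ∀ j x, 1 ≤ e j x := fun j x => by
    simp only [e, Pi.add_apply, Pi.mul_apply]
    nlinarith [mul_self_nonneg (T j x)]
  have mei : SmoothModerate Q fun j => (e j)⁻¹ := by
    refine me.inv hQ (fun j x => by linarith [he j x] |> fun h : 0 < e j x => h.ne') ?_
    refine .const hQ 1 (.of_forall fun j x => ?_)
    have := he j x
    rw [Pi.inv_apply, abs_of_nonneg (by positivity)]
    exact inv_le_one_of_one_le₀ this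
  have mq : SmoothModerate Q fun j _ => (Real.pi * q j)⁻¹ := by
    refine .constants hQ (m := 1) ?_
    filter_upwards [hQ.eventually_ge_atTop 1] with j hj
    have h1 : (1 : ℝ) ≤ q j := by exact_mod_cast hq j
    rw [abs_of_nonneg (by positivity), pow_one]
    refine (inv_le_one_of_one_le₀ ?_).trans hj
    nlinarith [Real.pi_gt_three]
  have hT : ∀ j x, T j x = r j * Real.sin (2 * Real.pi * q j * x) *
      (1 - r j * Real.cos (2 * Real.pi * q j * x))⁻¹ := fun j x => by
    simp only [T, Pi.mul_apply, Pi.inv_apply, hd, Function.comp_apply, one_mul, ℓ]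
  have : ∀ j, deriv (blaschke (q j) (r j))
      = (fun _ => 1) + (fun _ => (Real.pi * q j)⁻¹) * ((e j)⁻¹ * deriv (T j)) := by
    refine fun j => funext fun x => ?_
    have hb : blaschke (q j) (r j) = fun x => x + Real.arctan (T j x) / (Real.pi * q j) :=
      funext fun x => by rw [hT, blaschke]
    have h1 := ((differentiable_of_contDiff (mT.contDiff j) x).hasDerivAt.arctan).div_const
      (Real.pi * q j)
    rw [hb]
    refine ((hasDerivAt_id' x).add h1).deriv.trans ?_
    simp only [e, Pi.add_apply, Pi.mul_apply, Pi.inv_apply]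
    ring
  simp only [this]
  exact m1.add hQ (mq.mul hQ (mei.mul hQ mT.deriv))

/-- The translation `x ↦ x + t`. -/
def rot (t : ℝ) : CircleDeg1Liftˣ := CircleDeg1Lift.translate (Multiplicative.ofAdd t)

theorem rot_apply (t x : ℝ) : rot t x = x + t :=
  (CircleDeg1Lift.translate_apply t x).trans (add_comm _ _)

theorem rot_inv (t : ℝ) : (rot t)⁻¹ = rot (-t) := by
  rw [rot, rot, ← map_inv, ofAdd_neg]

theorem contDiff_rot (t : ℝ) : ContDiff ℝ ∞ (rot t) := contDiff_translate t

theorem unit_mul_apply (u v : CircleDeg1Liftˣ) (x : ℝ) : (u * v) x = u (v x) := rfl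

/-- The conjugate of a translation. -/
def conjRot (u : CircleDeg1Liftˣ) (t : ℝ) : CircleDeg1Liftˣ := u * rot t * u⁻¹

theorem conjRot_apply (u : CircleDeg1Liftˣ) (t x : ℝ) :
    conjRot u t x = u ((u⁻¹ : CircleDeg1Liftˣ) x + t) :=
  congrArg u (rot_apply _ _)

theorem conjRot_inv (u : CircleDeg1Liftˣ) (t : ℝ) : (conjRot u t)⁻¹ = conjRot u (-t) := by
  rw [conjRot, conjRot, ← rot_inv]
  group

/-- `h` is a smooth lift fixing `0` which is within `D` of the identity, and which, like its
inverse, stretches some interval of length at most `s` to an interval of length at least `D / 4`. -/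
structure IsStretch (D s : ℝ) (h : CircleDeg1Liftˣ) : Prop where
  smooth : SmoothLift h
  map_zero : h 0 = 0
  pos_s : 0 < s
  pos_D : 0 < D
  displacement : ∀ x, |h x - x| ≤ D
  displacement_inv : ∀ x, |(h⁻¹ : CircleDeg1Liftˣ) x - x| ≤ D
  stretch : ∃ u v, |u - v| ≤ s ∧ D / 4 ≤ |h u - h v|
  stretch_inv : ∃ u v, |u - v| ≤ s ∧
    D / 4 ≤ |(h⁻¹ : CircleDeg1Liftˣ) u - (h⁻¹ : CircleDeg1Liftˣ) v|

theorem isStretch_blaschkeUnit {q : ℕ} {r : ℝ} (hq : 0 < q) (hr : |r| < 1) :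
    IsStretch (q : ℝ)⁻¹ (1 - r) (blaschkeUnit q r hq hr) := by
  have hq' : (0 : ℝ) < q := by exact_mod_cast hq
  refine ⟨smoothLift_blaschkeUnit hq hr, ?_, ?_, by positivity, ?_, ?_, ?_, ?_⟩
  · rw [coe_blaschkeUnit, blaschke_zero]
  · linarith [(abs_lt.1 hr).2]
  · exact abs_blaschke_sub_le q r
  · exact abs_blaschke_sub_le q (-r)
  · refine ⟨blaschke q (-r) (1 / (4 * q)), 0, ?_, ?_⟩
    · rw [blaschke_quarter hq, Real.arctan_neg, sub_zero, neg_div, ← sub_eq_add_neg]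
      exact abs_quarter_sub_arctan_le hq hr
    · have := blaschke_neg_blaschke (r := -r) hq (by rwa [abs_neg]) (1 / (4 * q))
      rw [neg_neg] at this
      rw [coe_blaschkeUnit, this, blaschke_zero, sub_zero, abs_of_nonneg (by positivity)]
      apply le_of_eq
      field_simp
  · refine ⟨blaschke q r (1 / (4 * q)), blaschke q r (1 / (2 * q)), ?_, ?_⟩
    · rw [blaschke_quarter hq, blaschke_half hq, abs_sub_comm]
      refine le_trans (le_of_eq ?_) (abs_quarter_sub_arctan_le hq hr)
      congr 1
      ring
    · rw [coe_blaschkeUnit_inv, blaschke_neg_blaschke hq hr, blaschke_neg_blaschke hq hr,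
        abs_sub_comm, abs_of_nonneg]
      · apply le_of_eq
        field_simp
        norm_num
      · rw [sub_nonneg]
        gcongr
        norm_num

theorem conjRot_mul_sub_conjRot_tendsto {Q : ℕ → ℝ} (hQ : Tendsto Q atTop atTop) {q : ℕ → ℕ}
    {r : ℕ → ℝ} (hq : ∀ j, 0 < q j) (hr : ∀ j, |r j| < 1) (hqQ : ∀ j, (q j : ℝ) ≤ Q j)
    (hrQ : ∀ j, (1 - |r j|)⁻¹ ≤ Q j) {β : ℝ} {p : ℕ → ℤ}
    (hβ : ∀ j, |β - p j / q j| ≤ (Q j ^ j)⁻¹) {H : CircleDeg1Liftˣ} (hH : SmoothLift H) (k : ℕ)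
    {ε : ℝ} (hε : 0 < ε) :
    ∀ᶠ j in atTop, ∀ x, |iteratedDeriv k
      (⇑(conjRot (H * blaschkeUnit (q j) (r j) (hq j) (hr j)) β : CircleDeg1Lift) -
        ⇑(conjRot H β : CircleDeg1Lift)) x| ≤ ε := by
  have mb := moderateLift_blaschke hQ hq hr hqQ hrQ
  have mb' := moderateLift_blaschke hQ (r := fun j => -r j) hq (by simpa using hr) hqQ
    (by simpa using hrQ)
  have mH := ModerateLift.of_lift hQ hH.contDiff
  have mH' := ModerateLift.of_lift hQ hH.contDiff_inv
  have mt := ModerateLift.of_lift hQ (contDiff_rot β)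
  let u : ℕ → ℝ → ℝ := fun j =>
    (H ∘ blaschke (q j) (r j) ∘ rot β ∘ blaschke (q j) (-r j) ∘ (H⁻¹ : CircleDeg1Liftˣ)) -
      H ∘ rot β ∘ (H⁻¹ : CircleDeg1Liftˣ)
  have mu : ModerateLift Q u :=
    (mH.comp hQ (mb.comp hQ (mt.comp hQ (mb'.comp hQ mH')))).sub hQ (mH.comp hQ (mt.comp hQ mH'))
  have hu : ∀ j, ⇑(conjRot (H * blaschkeUnit (q j) (r j) (hq j) (hr j)) β : CircleDeg1Lift) -
        ⇑(conjRot H β : CircleDeg1Lift) = u j := by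
    intro j
    rw [conjRot, conjRot, mul_inv_rev]
    rfl
  simp only [hu]
  have hn : Negligible Q u := by
    intro m
    obtain ⟨L, hL0, hL⟩ := exists_lipschitz_of_contDiff hH.contDiff
    obtain ⟨c, hc⟩ := mb.deriv.moderate 0
    filter_upwards [hc, hQ.eventually_ge_atTop (2 * L), hQ.eventually_ge_atTop 1,
      eventually_ge_atTop (c + 1 + m)] with j hc hQL hQ1 hj x
    simp only [iteratedDeriv_zero] at hc
    have hQ0 : 0 < Q j := by linarith
    set z := (H⁻¹ : CircleDeg1Liftˣ) x
    set y := blaschke (q j) (-r j) z with hy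
    have hz : z = blaschke (q j) (r j) y := by
      have := blaschke_neg_blaschke (r := -r j) (hq j) (by simpa using hr j) z
      rw [neg_neg] at this
      exact this.symm
    set δ := β - p j / q j with hδ
    have e1 : blaschke (q j) (r j) (y + β) - (z + β)
        = blaschke (q j) (r j) (y + δ) - blaschke (q j) (r j) y - δ := by
      have : y + β = (y + δ) + p j / q j := by rw [hδ]; ring
      rw [this, blaschke_add_div (hq j), hz, hδ]
      ring
    have e2 : |blaschke (q j) (r j) (y + δ) - blaschke (q j) (r j) y| ≤ Q j ^ c * |y + δ - y| :=
      Convex.norm_image_sub_le_of_norm_deriv_le (s := Set.univ)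
        (fun y _ => differentiable_of_contDiff (mb.contDiff j) y) (fun y _ => hc y) convex_univ
        trivial trivial
    rw [add_sub_cancel_left] at e2
    have e3 : (1 : ℝ) ≤ Q j ^ c := one_le_pow₀ hQ1
    calc |u j x| = |H (blaschke (q j) (r j) (y + β)) - H (z + β)| := by
          simp only [u, Pi.sub_apply, Function.comp_apply, rot_apply]
          rfl
      _ ≤ L * |blaschke (q j) (r j) (y + β) - (z + β)| := hL _ _
      _ ≤ L * (2 * Q j ^ c * |δ|) := by
          rw [e1]
          gcongr
          refine (abs_sub _ _).trans ?_
          nlinarith [abs_nonneg δ]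
      _ = 2 * L * Q j ^ c * |δ| := by ring
      _ ≤ Q j * Q j ^ c * (Q j ^ (c + 1 + m))⁻¹ := by
          gcongr
          refine (hβ j).trans ?_
          gcongr
      _ = (Q j ^ m)⁻¹ := by
          rw [pow_add, pow_succ]
          field_simp
  exact (hn.iteratedDeriv hQ mu.contDiff mu.deriv k).tendsto hQ hε

/-- Liouville numbers admit stretching maps of arbitrarily small displacement which almost commute
with the rotation, in the `C^∞` sense. -/
theorem exists_stretching_sequence {α : ℝ} (hα : Liouville α) :
    ∃ (h : ℕ → CircleDeg1Liftˣ) (D s : ℕ → ℝ), (∀ j, IsStretch (D j) (s j) (h j)) ∧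
      Tendsto D atTop (𝓝 0) ∧ (∀ j, s j ≤ D j ^ j) ∧
      ∀ β, β = α ∨ β = -α → ∀ H : CircleDeg1Liftˣ, SmoothLift H → ∀ (k : ℕ) (ε : ℝ), 0 < ε →
        ∀ᶠ j in atTop, ∀ x, |iteratedDeriv k
          (⇑(conjRot (H * h j) β : CircleDeg1Lift) - ⇑(conjRot H β : CircleDeg1Lift)) x| ≤ ε := by
  have key : ∀ j : ℕ, ∃ (q : ℕ) (p : ℤ), j + 2 ≤ q ∧
      |α - p / q| ≤ (((q : ℝ) ^ (j + 1)) ^ j)⁻¹ := by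
    intro j
    obtain ⟨q, ⟨p, -, hp⟩, hq⟩ := ((hα.frequently_exists_num ((j + 1) * j)).and_eventually
      (eventually_ge_atTop (j + 2))).exists
    refine ⟨q, p, hq, ?_⟩
    rw [← pow_mul, ← one_div]
    exact hp.le
  choose q p hq hp using key
  have hq0 : ∀ j, 0 < q j := fun j => by have := hq j; omega
  have hq2 : ∀ j, (2 : ℝ) ≤ q j := fun j => by
    have := hq j
    exact_mod_cast (by omega : 2 ≤ q j)
  have hqj : ∀ j : ℕ, (j : ℝ) ≤ q j := fun j => by
    have := hq j
    exact_mod_cast (by omega : j ≤ q j)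
  let Q : ℕ → ℝ := fun j => (q j : ℝ) ^ (j + 1)
  have hqQ : ∀ j, (q j : ℝ) ≤ Q j := fun j => le_self_pow₀ (by linarith [hq2 j]) (by omega)
  have hqt : Tendsto (fun j => (q j : ℝ)) atTop atTop :=
    tendsto_atTop_mono hqj tendsto_natCast_atTop_atTop
  have hQ : Tendsto Q atTop atTop := tendsto_atTop_mono hqQ hqt
  have hQ2 : ∀ j, 2 ≤ Q j := fun j => (hq2 j).trans (hqQ j)
  let r : ℕ → ℝ := fun j => 1 - (Q j)⁻¹
  have hQi : ∀ j, 0 < (Q j)⁻¹ ∧ (Q j)⁻¹ < 1 := fun j =>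
    ⟨inv_pos.2 (by linarith [hQ2 j]), inv_lt_one_of_one_lt₀ (by linarith [hQ2 j])⟩
  have hra : ∀ j, |r j| = 1 - (Q j)⁻¹ := fun j => abs_of_nonneg (by linarith [(hQi j).2])
  have hr : ∀ j, |r j| < 1 := fun j => by linarith [hra j, (hQi j).1]
  have hrQ : ∀ j, (1 - |r j|)⁻¹ ≤ Q j := fun j => by rw [hra, sub_sub_cancel, inv_inv]
  refine ⟨fun j => blaschkeUnit (q j) (r j) (hq0 j) (hr j), fun j => (q j : ℝ)⁻¹,
    fun j => 1 - r j, fun j => isStretch_blaschkeUnit (hq0 j) (hr j),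
    tendsto_inv_atTop_zero.comp hqt, fun j => ?_, ?_⟩
  · have : 1 - r j = (Q j)⁻¹ := by simp [r]
    change 1 - r j ≤ (q j : ℝ)⁻¹ ^ j
    rw [this, inv_pow]
    exact inv_anti₀ (pow_pos (by linarith [hq2 j]) _)
      (pow_le_pow_right₀ (by linarith [hq2 j]) j.le_succ)
  · rintro β (rfl | rfl) H hH k ε hε
    · exact conjRot_mul_sub_conjRot_tendsto hQ hq0 hr hqQ hrQ hp hH k hε
    · refine conjRot_mul_sub_conjRot_tendsto hQ hq0 hr hqQ hrQ (p := fun j => -p j) (fun j => ?_)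
        hH k hε
      refine le_trans (le_of_eq ?_) (hp j)
      rw [← abs_neg]
      congr 1
      push_cast
      ring

/-- The product `φ₀^{a₀} ⋯ φₙ₋₁^{aₙ₋₁}`. -/
def word (φ : ℕ → CircleDeg1Liftˣ) (a : ℕ → Bool) : ℕ → CircleDeg1Liftˣ
  | 0 => 1
  | n + 1 => word φ a n * if a n then φ n else 1

theorem word_succ_of_true {φ : ℕ → CircleDeg1Liftˣ} {a : ℕ → Bool} {n : ℕ} (h : a n = true) :
    word φ a (n + 1) = word φ a n * φ n := by
  simp [word, h]

theorem word_succ_of_false {φ : ℕ → CircleDeg1Liftˣ} {a : ℕ → Bool} {n : ℕ} (h : a n = false) :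
    word φ a (n + 1) = word φ a n := by
  simp [word, h]

theorem word_congr {φ : ℕ → CircleDeg1Liftˣ} {a b : ℕ → Bool} {n : ℕ} (h : ∀ i < n, a i = b i) :
    word φ a n = word φ b n := by
  induction n with
  | zero => rfl
  | succ n ih => rw [word, word, ih fun i hi => h i (by omega), h n n.lt_succ_self]

/-- A sequence of stretching maps, each negligible at the scale of the previous ones, such that
conjugating the rotations by `±α` by their products changes little in the `C^∞` sense. -/
structure IsTower (α : ℝ) (φ : ℕ → CircleDeg1Liftˣ) (D s : ℕ → ℝ) : Prop where
  stretch : ∀ n, IsStretch (D n) (s n) (φ n)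
  D_le : ∀ n, D n ≤ 8⁻¹ * (1 / 2) ^ n
  s_le : ∀ n, s n ≤ D n ^ (n + 2)
  D_succ_le : ∀ n, D (n + 1) ≤ s n / 100
  lipschitz : ∀ a n x y, |word φ a n x - word φ a n y| ≤ (1 / 2) ^ n / D n * |x - y|
  lipschitz_inv : ∀ a n x y, |((word φ a n)⁻¹ : CircleDeg1Liftˣ) x -
    ((word φ a n)⁻¹ : CircleDeg1Liftˣ) y| ≤ (1 / 2) ^ n / D n * |x - y|
  close : ∀ β, β = α ∨ β = -α → ∀ a n k, k ≤ n → ∀ x, |iteratedDeriv k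
    (⇑(conjRot (word φ a n * φ n) β : CircleDeg1Lift) -
      ⇑(conjRot (word φ a n) β : CircleDeg1Lift)) x| ≤ (1 / 2) ^ n

theorem exists_isTower {α : ℝ} (hα : Liouville α) : ∃ φ D s, IsTower α φ D s := by
  obtain ⟨h, D, s, hst, hD, hs, hclose⟩ := exists_stretching_sequence hα
  let P : ℕ → Set CircleDeg1Liftˣ → ℝ → ℕ → Prop := fun n S η j =>
    D j ≤ 8⁻¹ * (1 / 2) ^ n ∧ D j ≤ η / 100 ∧ n + 2 ≤ j ∧
    (∀ H ∈ S, (∀ x y, |H x - H y| ≤ (1 / 2) ^ n / D j * |x - y|) ∧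
      (∀ x y, |(H⁻¹ : CircleDeg1Liftˣ) x - (H⁻¹ : CircleDeg1Liftˣ) y|
        ≤ (1 / 2) ^ n / D j * |x - y|) ∧
      ∀ β, β = α ∨ β = -α → ∀ k ≤ n, ∀ x, |iteratedDeriv k
        (⇑(conjRot (H * h j) β : CircleDeg1Lift) - ⇑(conjRot H β : CircleDeg1Lift)) x|
          ≤ (1 / 2) ^ n)
  have hDlt : ∀ ε : ℝ, 0 < ε → ∀ᶠ j in atTop, D j ≤ ε := fun ε hε =>
    (hD.eventually (gt_mem_nhds hε)).mono fun j hj => hj.le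
  have hlip : ∀ F : CircleDeg1Lift, ContDiff ℝ ∞ F → ∀ n : ℕ, ∀ᶠ j in atTop,
      ∀ x y, |F x - F y| ≤ (1 / 2) ^ n / D j * |x - y| := by
    intro F hF n
    obtain ⟨L, hL0, hL⟩ := exists_lipschitz_of_contDiff hF
    filter_upwards [hDlt ((1 / 2) ^ n / L) (by positivity)] with j hj x y
    refine (hL x y).trans ?_
    gcongr
    rw [le_div_iff₀ (hst j).pos_D]
    rw [le_div_iff₀ hL0] at hj
    linarith
  have key : ∀ n S η, (S.Finite ∧ (∀ H ∈ S, SmoothLift H) ∧ 0 < η) → ∃ j, P n S η j := by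
    rintro n S η ⟨hfin, hsm, hη⟩
    refine Eventually.exists (f := atTop) ?_
    refine (hDlt _ (by positivity)).and ((hDlt _ (by positivity)).and
      ((eventually_ge_atTop (n + 2)).and ?_))
    rw [eventually_all_finite hfin]
    intro H hH
    refine (hlip H (hsm H hH).contDiff n).and ((hlip _ (hsm H hH).contDiff_inv n).and ?_)
    have h1 : ∀ β, β = α ∨ β = -α → ∀ᶠ j in atTop, ∀ k ∈ Finset.range (n + 1),
        ∀ x, |iteratedDeriv k
        (⇑(conjRot (H * h j) β : CircleDeg1Lift) - ⇑(conjRot H β : CircleDeg1Lift)) x|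
          ≤ (1 / 2) ^ n := fun β hβ => by
      rw [eventually_all_finset]
      exact fun k _ => hclose β hβ H (hsm H hH) k _ (by positivity)
    filter_upwards [h1 α (.inl rfl), h1 (-α) (.inr rfl)] with j h2 h3
    rintro β (rfl | rfl) k hk
    · exact h2 k (Finset.mem_range.2 (by omega))
    · exact h3 k (Finset.mem_range.2 (by omega))
  choose! J hJ using key
  let st : ℕ → Set CircleDeg1Liftˣ × ℝ := fun n => Nat.rec ({1}, 1)
    (fun n p => (p.1 ∪ (fun H => H * h (J n p.1 p.2)) '' p.1, s (J n p.1 p.2))) n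
  let j : ℕ → ℕ := fun n => J n (st n).1 (st n).2
  have st_succ : ∀ n, st (n + 1) = ((st n).1 ∪ (fun H => H * h (j n)) '' (st n).1, s (j n)) :=
    fun _ => rfl
  have hgood : ∀ n, (st n).1.Finite ∧ (∀ H ∈ (st n).1, SmoothLift H) ∧ 0 < (st n).2 := by
    intro n
    induction n with
    | zero =>
      refine ⟨Set.finite_singleton _, ?_, one_pos⟩
      rintro H rfl
      exact .one
    | succ n ih =>
      rw [st_succ]
      refine ⟨ih.1.union (ih.1.image _), ?_, (hst _).pos_s⟩
      rintro H (hH | ⟨H, hH, rfl⟩)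
      · exact ih.2.1 H hH
      · exact (ih.2.1 H hH).mul (hst _).smooth
  have hP : ∀ n, P n (st n).1 (st n).2 (j n) := fun n => hJ n _ _ (hgood n)
  have hmem : ∀ a n, word (h ∘ j) a n ∈ (st n).1 := by
    intro a n
    induction n with
    | zero => exact rfl
    | succ n ih =>
      rw [st_succ]
      rcases ha : a n
      · rw [word_succ_of_false ha]
        exact .inl ih
      · rw [word_succ_of_true ha]
        exact .inr ⟨_, ih, rfl⟩
  refine ⟨h ∘ j, D ∘ j, s ∘ j, fun n => hst _, fun n => (hP n).1, fun n => ?_, fun n => ?_,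
    fun a n => ((hP n).2.2.2 _ (hmem a n)).1, fun a n => ((hP n).2.2.2 _ (hmem a n)).2.1,
    fun β hβ a n => ((hP n).2.2.2 _ (hmem a n)).2.2 β hβ⟩
  · refine (hs (j n)).trans (pow_le_pow_of_le_one (hst _).pos_D.le ((hP n).1.trans ?_) (hP n).2.2.1)
    have : (1 / 2 : ℝ) ^ n ≤ 1 := pow_le_one₀ (by norm_num) (by norm_num)
    linarith
  · have := (hP (n + 1)).2.1
    rwa [st_succ] at this

/-- A sequence of units of `CircleDeg1Lift` converging geometrically together with the inverses
has a limit unit. -/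
theorem exists_unit_limit (u : ℕ → CircleDeg1Liftˣ)
    (h : ∀ n x, |u (n + 1) x - u n x| ≤ (1 / 2) ^ n)
    (h' : ∀ n x, |((u (n + 1))⁻¹ : CircleDeg1Liftˣ) x - ((u n)⁻¹ : CircleDeg1Liftˣ) x|
      ≤ (1 / 2) ^ n) :
    ∃ v : CircleDeg1Liftˣ, (∀ n x, |u n x - v x| ≤ 2 * (1 / 2) ^ n) ∧
      ∀ x, Tendsto (fun n => ((u n)⁻¹ : CircleDeg1Liftˣ) x) atTop
        (𝓝 ((v⁻¹ : CircleDeg1Liftˣ) x)) := by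
  have aux : ∀ w : ℕ → CircleDeg1Liftˣ, (∀ n x, |w (n + 1) x - w n x| ≤ (1 / 2) ^ n) →
      ∃ F : CircleDeg1Lift, Continuous F ∧ (∀ x, Tendsto (fun n => w n x) atTop (𝓝 (F x))) ∧
        ∀ n x, |w n x - F x| ≤ 2 * (1 / 2) ^ n := by
    intro w hw
    have hdist : ∀ x n, dist (w n x) (w (n + 1) x) ≤ 1 * (1 / 2) ^ n := fun x n => by
      rw [dist_comm, Real.dist_eq, one_mul]
      exact hw n x
    have hc : ∀ x, ∃ y, Tendsto (fun n => w n x) atTop (𝓝 y) := fun x =>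
      cauchySeq_tendsto_of_complete (cauchySeq_of_le_geometric _ _ (by norm_num) (hdist x))
    choose F hF using hc
    have hb : ∀ n x, |w n x - F x| ≤ 2 * (1 / 2) ^ n := fun n x => by
      have := dist_le_of_le_geometric_of_tendsto (1 / 2) 1 (by norm_num) (hdist x) (hF x) n
      rw [Real.dist_eq] at this
      refine this.trans (le_of_eq ?_)
      ring
    refine ⟨⟨⟨F, fun x y hxy => ?_⟩, fun x => ?_⟩, ?_, hF, hb⟩
    · exact le_of_tendsto_of_tendsto' (hF x) (hF y) fun n => (w n : CircleDeg1Lift).mono hxy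
    · refine tendsto_nhds_unique (hF (x + 1)) ?_
      simp only [CircleDeg1Lift.map_add_one]
      exact (hF x).add_const 1
    · have hu : TendstoUniformly (fun n x => w n x) F atTop := by
        rw [Metric.tendstoUniformly_iff]
        intro ε hε
        have ht : Tendsto (fun n : ℕ => 2 * (1 / 2 : ℝ) ^ n) atTop (𝓝 (2 * 0)) :=
          (tendsto_pow_atTop_nhds_zero_of_lt_one (by norm_num) (by norm_num)).const_mul 2
        rw [mul_zero] at ht
        filter_upwards [ht.eventually (gt_mem_nhds hε)] with n hn x
        rw [dist_comm, Real.dist_eq]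
        exact (hb n x).trans_lt hn
      refine hu.continuous (.of_forall fun n => ?_)
      exact (CircleDeg1Lift.continuous_iff_surjective _).2
        (CircleDeg1Lift.isUnit_iff_bijective.1 (w n).isUnit).2
  obtain ⟨F, cF, hF, bF⟩ := aux u h
  obtain ⟨G, cG, hG, bG⟩ := aux (fun n => (u n)⁻¹) h'
  have hz : Tendsto (fun n : ℕ => 2 * (1 / 2 : ℝ) ^ n) atTop (𝓝 0) := by
    simpa using (tendsto_pow_atTop_nhds_zero_of_lt_one (r := (1 / 2 : ℝ)) (by norm_num)
      (by norm_num)).const_mul 2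
  have inv_of : ∀ (w : ℕ → CircleDeg1Liftˣ) (A B : CircleDeg1Lift), Continuous A →
      (∀ n x, |w n x - A x| ≤ 2 * (1 / 2) ^ n) →
      (∀ x, Tendsto (fun n => ((w n)⁻¹ : CircleDeg1Liftˣ) x) atTop (𝓝 (B x))) → A * B = 1 := by
    intro w A B cA bA hB
    refine CircleDeg1Lift.ext fun x => ?_
    have h1 : Tendsto (fun n => A (((w n)⁻¹ : CircleDeg1Liftˣ) x)) atTop (𝓝 (A (B x))) :=
      (cA.tendsto _).comp (hB x)
    have h2 : Tendsto (fun n => A (((w n)⁻¹ : CircleDeg1Liftˣ) x)) atTop (𝓝 x) := by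
      rw [tendsto_iff_dist_tendsto_zero]
      refine squeeze_zero (fun _ => dist_nonneg) (fun n => ?_) hz
      have := bA n (((w n)⁻¹ : CircleDeg1Liftˣ) x)
      rw [CircleDeg1Lift.units_apply_inv_apply] at this
      rwa [dist_comm, Real.dist_eq]
    exact tendsto_nhds_unique h1 h2
  refine ⟨⟨F, G, inv_of u F G cF bF hG, inv_of (fun n => (u n)⁻¹) G F cG bG ?_⟩, bF, hG⟩
  simpa only [inv_inv] using hF

/-- Smoothness of limits of sequences converging geometrically in every `C^k` norm. -/
theorem contDiff_limit {f : ℕ → ℝ → ℝ} {g : ℝ → ℝ} (hf : ∀ n, ContDiff ℝ ∞ (f n))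
    (h : ∀ n k, k ≤ n → ∀ x, |iteratedDeriv k (f (n + 1) - f n) x| ≤ (1 / 2) ^ n)
    (hg : ∀ x, Tendsto (fun n => f n x) atTop (𝓝 (g x))) :
    ContDiff ℝ ∞ g ∧ ∀ n k, k ≤ n → ∀ x, |iteratedDeriv k (g - f n) x| ≤ 2 * (1 / 2) ^ n := by
  have key : ∀ n : ℕ, ContDiff ℝ n (g - f n) ∧
      ∀ k, k ≤ n → ∀ x, |iteratedDeriv k (g - f n) x| ≤ 2 * (1 / 2) ^ n := by
    intro n
    let F : ℕ → ℝ → ℝ := fun i => f (n + i + 1) - f (n + i)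
    let v : ℕ → ℕ → ℝ := fun _ i => (1 / 2) ^ n * (1 / 2) ^ i
    have hv : HasSum (v 0) ((1 / 2) ^ n * 2) := hasSum_geometric_two.mul_left _
    have hF : ∀ i, ContDiff ℝ n (F i) := fun i =>
      ((hf _).sub (hf _)).of_le (by exact_mod_cast le_top)
    have hb : ∀ (k i : ℕ) (x : ℝ), (k : ℕ∞) ≤ (n : ℕ∞) → ‖iteratedFDeriv ℝ k (F i) x‖ ≤ v k i := by
      intro k i x hk
      rw [norm_iteratedFDeriv_eq_norm_iteratedDeriv]
      simp only [v, ← pow_add]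
      exact h (n + i) k ((by exact_mod_cast hk : k ≤ n).trans (by omega)) x
    have hs : g - f n = fun x => ∑' i, F i x := by
      funext x
      have hsum : Summable fun i => F i x := by
        refine Summable.of_norm_bounded hv.summable fun i => ?_
        have := hb 0 i x (by simp)
        rwa [norm_iteratedFDeriv_zero] at this
      refine (tendsto_nhds_unique hsum.hasSum.tendsto_sum_nat ?_).symm
      have : ∀ m, ∑ i ∈ Finset.range m, F i x = f (n + m) x - f n x := by
        intro m
        exact Finset.sum_range_sub (fun i => f (n + i) x) m
      simp only [this]
      refine Tendsto.sub_const ?_ _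
      have := (tendsto_add_atTop_iff_nat n).2 (hg x)
      simpa only [add_comm n] using this
    rw [hs]
    refine ⟨contDiff_tsum (N := (n : ℕ∞)) hF (fun _ _ => hv.summable) hb, fun k hk x => ?_⟩
    have hkn : (k : ℕ∞) ≤ (n : ℕ∞) := by exact_mod_cast hk
    have e := iteratedFDeriv_tsum_apply (N := (n : ℕ∞)) hF (fun _ _ => hv.summable) hb hkn x
    rw [← Real.norm_eq_abs, ← norm_iteratedFDeriv_eq_norm_iteratedDeriv, e, mul_comm]
    exact tsum_of_norm_bounded hv fun i => hb k i x hkn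
  refine ⟨contDiff_infty.2 fun n => ?_, fun n => (key n).2⟩
  have := (key n).1.add ((hf n).of_le (by exact_mod_cast le_top : (n : WithTop ℕ∞) ≤ ∞))
  simpa using this

/-- The map of the circle induced by a degree one lift. -/
def circleMap (F : CircleDeg1Lift) : UnitAddCircle → UnitAddCircle :=
  Function.Periodic.lift (f := fun x : ℝ => ((F x : ℝ) : UnitAddCircle)) (c := 1) fun x => by
    beta_reduce
    rw [F.map_add_one, AddCircle.coe_add, AddCircle.coe_period, add_zero]

theorem continuous_unit (u : CircleDeg1Liftˣ) : Continuous u :=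
  (CircleDeg1Lift.continuous_iff_surjective _).2
    (CircleDeg1Lift.isUnit_iff_bijective.1 u.isUnit).2

theorem continuous_circleMap (u : CircleDeg1Liftˣ) : Continuous (circleMap u) :=
  continuous_coinduced_dom.2 ((AddCircle.continuous_mk' 1).comp (continuous_unit u))

/-- The circle homeomorphism with a given lift. -/
def toCircleHomeo (u : CircleDeg1Liftˣ) : CircleHomeo where
  toHomeo :=
    { toFun := circleMap u
      invFun := circleMap (u⁻¹ : CircleDeg1Liftˣ)
      left_inv := fun y => by
        obtain ⟨x, rfl⟩ := QuotientAddGroup.mk_surjective y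
        exact congrArg _ (CircleDeg1Lift.units_inv_apply_apply u x)
      right_inv := fun y => by
        obtain ⟨x, rfl⟩ := QuotientAddGroup.mk_surjective y
        exact congrArg _ (CircleDeg1Lift.units_apply_inv_apply u x)
      continuous_toFun := continuous_circleMap u
      continuous_invFun := continuous_circleMap u⁻¹ }
  exists_lift := ⟨u, continuous_unit u, fun _ => rfl⟩

theorem toCircleHomeo_coe (u : CircleDeg1Liftˣ) (x : ℝ) :
    toCircleHomeo u (x : UnitAddCircle) = ((u x : ℝ) : UnitAddCircle) := rfl

theorem isLift_toCircleHomeo (u : CircleDeg1Liftˣ) : IsLift u (toCircleHomeo u) :=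
  ⟨continuous_unit u, fun _ => rfl⟩

theorem exists_lift_toCircleHomeo (u : CircleDeg1Liftˣ) :
    ∃ m : ℤ, ⇑(toCircleHomeo u).lift = fun x => u x + m := by
  obtain ⟨m, hm⟩ := (isLift_toCircleHomeo u).eq_add_int (toCircleHomeo u).isLift_lift
  exact ⟨m, funext hm⟩

theorem contDiff_lift_toCircleHomeo {u : CircleDeg1Liftˣ} (hu : ContDiff ℝ ∞ u) :
    ContDiff ℝ ∞ (toCircleHomeo u).lift := by
  obtain ⟨m, hm⟩ := exists_lift_toCircleHomeo u
  rw [hm]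
  exact hu.add contDiff_const

/-- The circle diffeomorphism with a given smooth lift. -/
def toCircleDiffeo (u : CircleDeg1Liftˣ) (hu : SmoothLift u) : CircleDiffeo where
  toCircleHomeo := toCircleHomeo u
  contDiff_lift := contDiff_lift_toCircleHomeo hu.contDiff
  contDiff_lift_symm := contDiff_lift_toCircleHomeo hu.contDiff_inv

theorem rotationNumber_toCircleHomeo (u : CircleDeg1Liftˣ) :
    (toCircleHomeo u).rotationNumber
      = ((CircleDeg1Lift.translationNumber u : ℝ) : UnitAddCircle) := by
  obtain ⟨m, hm⟩ := exists_lift_toCircleHomeo u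
  have e : (toCircleHomeo u).lift = (rot m * u : CircleDeg1Lift) := CircleDeg1Lift.ext fun x => by
    rw [hm, CircleDeg1Lift.mul_apply, rot_apply]
  have hc : Commute (rot m : CircleDeg1Lift) u := CircleDeg1Lift.ext fun x => by
    rw [CircleDeg1Lift.mul_apply, CircleDeg1Lift.mul_apply, rot_apply, rot_apply,
      CircleDeg1Lift.map_add_int]
  rw [CircleHomeo.rotationNumber, e, CircleDeg1Lift.translationNumber_mul_of_commute hc, rot,
    CircleDeg1Lift.translationNumber_translate, AddCircle.coe_add]
  have : ((m : ℝ) : UnitAddCircle) = 0 := (AddCircle.coe_eq_zero_iff 1).2 ⟨m, by simp⟩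
  rw [this, zero_add]

theorem translationNumber_conjRot (u : CircleDeg1Liftˣ) (t : ℝ) :
    CircleDeg1Lift.translationNumber (conjRot u t) = t :=
  (CircleDeg1Lift.translationNumber_conj_eq u (rot t)).trans
    (CircleDeg1Lift.translationNumber_translate t)

theorem derivGap_toCircleHomeo_le {u v : CircleDeg1Liftˣ} (hu : ContDiff ℝ ∞ u)
    (hv : ContDiff ℝ ∞ v) (i : ℕ) (x : ℝ) :
    CircleHomeo.derivGap (toCircleHomeo u) (toCircleHomeo v) i x ≤
      |iteratedDeriv i (⇑(u : CircleDeg1Lift) - ⇑(v : CircleDeg1Lift)) x| := by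
  cases i with
  | zero =>
    rw [CircleHomeo.derivGap, toCircleHomeo_coe, toCircleHomeo_coe, ← AddCircle.coe_sub,
      iteratedDeriv_zero]
    exact QuotientAddGroup.norm_mk_le_norm
  | succ i =>
    obtain ⟨m, hm⟩ := exists_lift_toCircleHomeo u
    obtain ⟨l, hl⟩ := exists_lift_toCircleHomeo v
    have aux : ∀ (f : ℝ → ℝ) (c : ℝ), iteratedDeriv (i + 1) (fun y => f y + c)
        = iteratedDeriv (i + 1) f := fun f c => by
      rw [iteratedDeriv_succ', iteratedDeriv_succ']
      congr 1
      exact funext fun y => deriv_add_const c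
    rw [CircleHomeo.derivGap, hm, hl, aux, aux, iteratedDeriv_sub
      (hu.of_le (by exact_mod_cast le_top)).contDiffAt
      (hv.of_le (by exact_mod_cast le_top)).contDiffAt]

theorem normGap_toCircleHomeo_le {u v : CircleDeg1Liftˣ} (hu : ContDiff ℝ ∞ u)
    (hv : ContDiff ℝ ∞ v) {k : ℕ} {ε : ℝ}
    (h : ∀ i ≤ k, ∀ x,
      |iteratedDeriv i (⇑(u : CircleDeg1Lift) - ⇑(v : CircleDeg1Lift)) x| ≤ ε) :
    CircleHomeo.normGap k (toCircleHomeo u) (toCircleHomeo v) ≤ ε :=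
  Finset.sup'_le _ _ fun i hi => ciSup_le fun x =>
    (derivGap_toCircleHomeo_le hu hv i x).trans
      (h i (Nat.lt_succ_iff.1 (Finset.mem_range.1 hi)) x)

theorem tendsto_distInf_of_tendsto_distK {ι : Type*} {l : Filter ι} {f : ι → CircleDiffeo}
    {g : CircleDiffeo} (h : ∀ k, Tendsto (fun i => CircleDiffeo.distK k (f i) g) l (𝓝 0)) :
    Tendsto f l (𝓝 g) := by
  rw [tendsto_iff_dist_tendsto_zero]
  have key := tendsto_tsum_of_dominated_convergence (𝓕 := l)
    (f := fun i k => CircleDiffeo.distK (k + 1) (f i) g /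
      (2 ^ (k + 1) * (1 + CircleDiffeo.distK (k + 1) (f i) g)))
    (g := fun _ : ℕ => (0 : ℝ)) (bound := fun k => (1 / 2 : ℝ) ^ k) summable_geometric_two
    (fun k => ?_) (.of_forall fun i k => ?_)
  · rw [tsum_zero] at key
    exact key
  · have := (h (k + 1)).div (((h (k + 1)).const_add 1).const_mul (2 ^ (k + 1))) (by positivity)
    simpa [Pi.div_def] using this
  · rw [Real.norm_of_nonneg (CircleDiffeo.term_nonneg _ _ _)]
    exact CircleDiffeo.term_le _ _ _

/-- A degree one homeomorphism which commutes with an irrational rotation is a translation. -/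
theorem eq_rot_of_semiconj {V : CircleDeg1Liftˣ} {α : ℝ} (hα : Irrational α)
    (h : ∀ x, V (x + α) = V x + α) : ∃ t, V = rot t := by
  have hper : ∀ c ∈ AddSubgroup.closure {α, 1}, ∀ x, V (x + c) = V x + c := by
    intro c hc
    induction hc using AddSubgroup.closure_induction with
    | mem c hc =>
      rcases hc with rfl | rfl
      · exact h
      · exact (V : CircleDeg1Lift).map_add_one
    | zero => simp
    | add c d _ _ hc hd =>
      intro x
      rw [← add_assoc, hd, hc, add_assoc]
    | neg c _ hc =>
      intro x
      have := hc (x + -c)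
      rw [neg_add_cancel_right] at this
      linarith
  have hd : Dense (AddSubgroup.closure {α, 1} : Set ℝ) :=
    dense_addSubgroupClosure_pair_iff.2 (by simpa using hα)
  have heq : (fun c => V c) = fun c => V 0 + c := by
    refine (continuous_unit V).ext_on hd (by fun_prop) fun c hc => ?_
    have := hper c hc 0
    rwa [zero_add] at this
  refine ⟨V 0, Units.ext (CircleDeg1Lift.ext fun x => ?_)⟩
  rw [rot_apply, add_comm]
  exact congrFun heq x

/-- Conjugacies between conjugates of an irrational rotation are determined up to a translation. -/
theorem eq_mul_rot_mul_inv {α : ℝ} (hα : Irrational α) {v w g : CircleDeg1Liftˣ} {m : ℤ}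
    (h : ∀ x, conjRot v α (g x) = g (conjRot w α x) + m) : ∃ t, g = v * rot t * w⁻¹ := by
  have h1 : conjRot v α * g = rot m * (g * conjRot w α) :=
    Units.ext (CircleDeg1Lift.ext fun x => (h x).trans (rot_apply _ _).symm)
  set V := v⁻¹ * g * w with hV
  have hcomm : ∀ x : CircleDeg1Liftˣ, rot m * x = x * rot m := fun x =>
    Units.ext (CircleDeg1Lift.ext fun y => by
      change rot m (x y) = x (rot m y)
      rw [rot_apply, rot_apply, CircleDeg1Lift.map_add_int])
  have h2 : rot α * V = rot m * (V * rot α) := by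
    have : rot α * V = v⁻¹ * (conjRot v α * g) * w := by
      rw [conjRot, hV]
      group
    rw [this, h1, ← mul_assoc (v⁻¹), ← hcomm, conjRot, hV]
    group
  have h3 : ∀ x, V x + α = V (x + α) + m := fun x => by
    have := congrArg (fun u : CircleDeg1Liftˣ => u x) h2
    simpa only [unit_mul_apply, rot_apply] using this
  have h4 : conjRot V α = rot (α - m) := Units.ext (CircleDeg1Lift.ext fun x => by
    rw [conjRot_apply, rot_apply]
    have := h3 ((V⁻¹ : CircleDeg1Liftˣ) x)
    rw [CircleDeg1Lift.units_apply_inv_apply] at this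
    linarith)
  have h5 : α = α - m := by
    rw [← translationNumber_conjRot V α, h4]
    exact (CircleDeg1Lift.translationNumber_translate _).trans (by
      rw [← h4, translationNumber_conjRot])
  obtain ⟨t, ht⟩ := eq_rot_of_semiconj hα (V := V) fun x => by linarith [h3 x]
  refine ⟨t, ?_⟩
  rw [← ht, hV]
  group

/-- Lifts of Hölder continuous circle homeomorphisms are Hölder continuous. -/
theorem holder_of_isLift {C β : ℝ≥0} {h : UnitAddCircle → UnitAddCircle} (hh : HolderWith C β h)
    {g : CircleDeg1Lift} (hg : IsLift g h) {x y : ℝ} (hxy : |x - y| ≤ 1) :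
    |g x - g y| ≤ 2 * C * |x - y| ^ (β : ℝ) := by
  wlog hle : x ≤ y generalizing x y
  · rw [abs_sub_comm, abs_sub_comm x y]
    exact this (by rwa [abs_sub_comm]) (le_of_not_ge hle)
  have hcirc : ∀ z w : ℝ, ‖((g z - g w : ℝ) : UnitAddCircle)‖ ≤ C * |z - w| ^ (β : ℝ) := by
    intro z w
    have h1 := hh.dist_le (z : UnitAddCircle) (w : UnitAddCircle)
    rw [← hg.2, ← hg.2, dist_eq_norm, dist_eq_norm, ← AddCircle.coe_sub,
      ← AddCircle.coe_sub] at h1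
    refine h1.trans ?_
    gcongr
    exact QuotientAddGroup.norm_mk_le_norm
  have hnorm : ∀ t : ℝ, |t| ≤ 1 / 2 → ‖(t : UnitAddCircle)‖ = |t| := fun t ht =>
    (AddCircle.norm_coe_eq_abs_iff 1 one_ne_zero).2 (by simpa using ht)
  have hpos : 0 ≤ C * |x - y| ^ (β : ℝ) := by positivity
  have hmono := g.mono hle
  rcases le_or_gt (1 / 2) (C * |x - y| ^ (β : ℝ)) with hC | hC
  · have : g y ≤ g x + 1 := by
      rw [← g.map_add_one]
      refine g.mono ?_
      linarith [(abs_le.1 hxy).1]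
    rw [abs_le]
    constructor <;> linarith
  · rcases le_or_gt (|g x - g y|) (1 / 2) with hs | hs
    · have := hcirc x y
      rw [hnorm _ hs] at this
      linarith
    · exfalso
      rw [abs_sub_comm, abs_of_nonneg (by linarith)] at hs
      obtain ⟨z, hz, hgz⟩ := intermediate_value_Icc hle hg.1.continuousOn
        (show g x + 1 / 2 ∈ Set.Icc (g x) (g y) from ⟨by linarith, by linarith⟩)
      have h1 := hcirc x z
      have e : g x - g z = -(1 / 2) := by rw [hgz]; ring
      have e2 : |(-(1 / 2) : ℝ)| = 1 / 2 := by norm_num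
      rw [e, hnorm _ e2.le, e2] at h1
      have h2 : (C : ℝ) * |x - z| ^ (β : ℝ) ≤ C * |x - y| ^ (β : ℝ) := by
        gcongr ?_ * ?_ ^ _
        rw [abs_of_nonpos (by linarith [hz.1]), abs_of_nonpos (by linarith)]
        linarith [hz.2]
      linarith

/-- `v` is the infinite product `φ₀^{a₀} φ₁^{a₁} ⋯`. -/
structure IsWordLimit (φ : ℕ → CircleDeg1Liftˣ) (a : ℕ → Bool) (v : CircleDeg1Liftˣ) : Prop where
  abs_sub_le : ∀ n x, |word φ a n x - v x| ≤ 2 * (1 / 2) ^ n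
  tendsto_inv : ∀ x, Tendsto (fun n => ((word φ a n)⁻¹ : CircleDeg1Liftˣ) x) atTop
    (𝓝 ((v⁻¹ : CircleDeg1Liftˣ) x))

theorem tendsto_two_mul_half_pow : Tendsto (fun n : ℕ => 2 * (1 / 2 : ℝ) ^ n) atTop (𝓝 0) := by
  simpa using (tendsto_pow_atTop_nhds_zero_of_lt_one (r := (1 / 2 : ℝ)) (by norm_num)
    (by norm_num)).const_mul 2

theorem abs_inv_sub_le {u : CircleDeg1Liftˣ} {η : ℝ} (h : ∀ x, |u x - x| ≤ η) (x : ℝ) :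
    |(u⁻¹ : CircleDeg1Liftˣ) x - x| ≤ η := by
  have := h ((u⁻¹ : CircleDeg1Liftˣ) x)
  rwa [CircleDeg1Lift.units_apply_inv_apply, abs_sub_comm] at this

/-- If `u` and `v` are within `η` of the identity, then `u ∘ rot t ∘ v` distorts distances by at
most `4 η`. -/
theorem abs_apply_rot_apply_sub_le {u v : CircleDeg1Liftˣ} {η : ℝ} (hu : ∀ x, |u x - x| ≤ η)
    (hv : ∀ x, |v x - x| ≤ η) (t x y : ℝ) :
    |(u (rot t (v x)) - u (rot t (v y))) - (x - y)| ≤ 4 * η := by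
  rw [rot_apply, rot_apply]
  have h1 := abs_le.1 (hu (v x + t))
  have h2 := abs_le.1 (hu (v y + t))
  have h3 := abs_le.1 (hv x)
  have h4 := abs_le.1 (hv y)
  rw [abs_le]
  constructor <;> linarith

namespace IsWordLimit

variable {φ : ℕ → CircleDeg1Liftˣ} {a : ℕ → Bool} {v : CircleDeg1Liftˣ}

theorem tendsto (hv : IsWordLimit φ a v) (x : ℝ) :
    Tendsto (fun n => word φ a n x) atTop (𝓝 (v x)) := by
  rw [tendsto_iff_dist_tendsto_zero]
  exact squeeze_zero (fun _ => dist_nonneg) (fun n => hv.abs_sub_le n x) tendsto_two_mul_half_pow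

theorem tendsto_conjRot (hv : IsWordLimit φ a v) (t x : ℝ) :
    Tendsto (fun n => conjRot (word φ a n) t x) atTop (𝓝 (conjRot v t x)) := by
  simp only [conjRot_apply]
  have h1 : Tendsto (fun n => ((word φ a n)⁻¹ : CircleDeg1Liftˣ) x + t) atTop
      (𝓝 ((v⁻¹ : CircleDeg1Liftˣ) x + t)) := (hv.tendsto_inv x).add_const t
  have h2 := ((continuous_unit v).tendsto _).comp h1
  refine h2.congr_dist ?_
  refine squeeze_zero (fun _ => dist_nonneg) (fun n => ?_) tendsto_two_mul_half_pow
  rw [dist_comm]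
  exact hv.abs_sub_le n _

end IsWordLimit

namespace IsTower

variable {α : ℝ} {φ : ℕ → CircleDeg1Liftˣ} {D s : ℕ → ℝ}

theorem D_pos (h : IsTower α φ D s) (n : ℕ) : 0 < D n := (h.stretch n).pos_D

theorem D_le_eighth (h : IsTower α φ D s) (n : ℕ) : D n ≤ 8⁻¹ := by
  have : (1 / 2 : ℝ) ^ n ≤ 1 := pow_le_one₀ (by norm_num) (by norm_num)
  linarith [h.D_le n]

theorem D_le_half_pow (h : IsTower α φ D s) (n : ℕ) : D n ≤ (1 / 2) ^ n := by
  have : (0 : ℝ) < (1 / 2) ^ n := by positivity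
  linarith [h.D_le n]

theorem s_le_D_sq (h : IsTower α φ D s) (n : ℕ) : s n ≤ D n ^ 2 :=
  (h.s_le n).trans (pow_le_pow_of_le_one (h.D_pos n).le
    ((h.D_le_eighth n).trans (by norm_num)) (by omega))

theorem s_le_D_div (h : IsTower α φ D s) (n : ℕ) : s n ≤ D n / 8 := by
  nlinarith [h.s_le_D_sq n, h.D_pos n, h.D_le_eighth n]

theorem D_succ_le_half (h : IsTower α φ D s) (n : ℕ) : D (n + 1) ≤ D n / 2 := by
  linarith [h.D_succ_le n, h.s_le_D_div n, h.D_pos n]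

theorem smoothLift_word (h : IsTower α φ D s) (a : ℕ → Bool) (n : ℕ) :
    SmoothLift (word φ a n) := by
  induction n with
  | zero => exact .one
  | succ n ih =>
    rcases ha : a n
    · rwa [word_succ_of_false ha]
    · rw [word_succ_of_true ha]
      exact ih.mul (h.stretch n).smooth

theorem word_zero (h : IsTower α φ D s) (a : ℕ → Bool) (n : ℕ) : word φ a n 0 = 0 := by
  induction n with
  | zero => rfl
  | succ n ih =>
    rcases ha : a n
    · rwa [word_succ_of_false ha]
    · rw [word_succ_of_true ha, unit_mul_apply, (h.stretch n).map_zero, ih]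

theorem abs_word_succ_sub_le (h : IsTower α φ D s) (a : ℕ → Bool) (n : ℕ) (x : ℝ) :
    |word φ a (n + 1) x - word φ a n x| ≤ (1 / 2) ^ n := by
  rcases ha : a n
  · rw [word_succ_of_false ha, sub_self, abs_zero]
    positivity
  · rw [word_succ_of_true ha, unit_mul_apply]
    refine (h.lipschitz a n _ _).trans ?_
    have := h.D_pos n
    calc (1 / 2 : ℝ) ^ n / D n * |φ n x - x| ≤ (1 / 2) ^ n / D n * D n := by
          gcongr
          exact (h.stretch n).displacement x
      _ = (1 / 2) ^ n := by field_simp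

theorem abs_word_succ_inv_sub_le (h : IsTower α φ D s) (a : ℕ → Bool) (n : ℕ) (x : ℝ) :
    |((word φ a (n + 1))⁻¹ : CircleDeg1Liftˣ) x - ((word φ a n)⁻¹ : CircleDeg1Liftˣ) x|
      ≤ D n := by
  rcases ha : a n
  · rw [word_succ_of_false ha, sub_self, abs_zero]
    exact (h.D_pos n).le
  · rw [word_succ_of_true ha, mul_inv_rev, unit_mul_apply]
    exact (h.stretch n).displacement_inv _

theorem exists_isWordLimit (h : IsTower α φ D s) (a : ℕ → Bool) : ∃ v, IsWordLimit φ a v := by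
  obtain ⟨v, h1, h2⟩ := exists_unit_limit (word φ a) (h.abs_word_succ_sub_le a)
    fun n x => (h.abs_word_succ_inv_sub_le a n x).trans (h.D_le_half_pow n)
  exact ⟨v, h1, h2⟩

variable {a b : ℕ → Bool} {v w : CircleDeg1Liftˣ}

theorem abs_inv_sub_word_inv_le (h : IsTower α φ D s) (hv : IsWordLimit φ a v) (n : ℕ) (x : ℝ) :
    |(v⁻¹ : CircleDeg1Liftˣ) x - ((word φ a n)⁻¹ : CircleDeg1Liftˣ) x| ≤ 2 * D n := by
  have key : ∀ m, |((word φ a (n + m))⁻¹ : CircleDeg1Liftˣ) x -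
      ((word φ a n)⁻¹ : CircleDeg1Liftˣ) x| ≤ 2 * D n - 2 * D (n + m) := by
    intro m
    induction m with
    | zero => simp
    | succ m ih =>
      have h1 := h.abs_word_succ_inv_sub_le a (n + m) x
      have h2 := h.D_succ_le_half (n + m)
      rw [← add_assoc]
      refine (abs_sub_le _ (((word φ a (n + m))⁻¹ : CircleDeg1Liftˣ) x) _).trans ?_
      linarith
  have ht := (tendsto_add_atTop_iff_nat n).2 (hv.tendsto_inv x)
  refine le_of_tendsto ((ht.sub_const _).abs) (.of_forall fun m => ?_)
  rw [add_comm m n]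
  linarith [key m, h.D_pos (n + m)]

theorem abs_tail_inv_sub_le (h : IsTower α φ D s) (hv : IsWordLimit φ a v) (n : ℕ) (x : ℝ) :
    |(((word φ a n)⁻¹ * v)⁻¹ : CircleDeg1Liftˣ) x - x| ≤ 2 * D n := by
  have := h.abs_inv_sub_word_inv_le hv n (word φ a n x)
  rw [CircleDeg1Lift.units_inv_apply_apply] at this
  rwa [mul_inv_rev, inv_inv, unit_mul_apply]

theorem abs_tail_sub_le (h : IsTower α φ D s) (hv : IsWordLimit φ a v) (n : ℕ) (x : ℝ) :
    |((word φ a n)⁻¹ * v : CircleDeg1Liftˣ) x - x| ≤ 2 * D n := by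
  have := abs_inv_sub_le (h.abs_tail_inv_sub_le hv n) x
  rwa [inv_inv] at this

theorem conjRot_limit (h : IsTower α φ D s) (hv : IsWordLimit φ a v) {β : ℝ}
    (hβ : β = α ∨ β = -α) : ContDiff ℝ ∞ (conjRot v β) ∧ ∀ n k, k ≤ n → ∀ x,
      |iteratedDeriv k (⇑(conjRot v β : CircleDeg1Lift) -
        ⇑(conjRot (word φ a n) β : CircleDeg1Lift)) x| ≤ 2 * (1 / 2) ^ n := by
  refine contDiff_limit (f := fun n => ⇑(conjRot (word φ a n) β : CircleDeg1Lift)) (fun n => ?_)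
    (fun n k hk x => ?_) (hv.tendsto_conjRot β)
  · have := h.smoothLift_word a n
    exact this.contDiff.comp ((contDiff_rot β).comp this.contDiff_inv)
  · rcases ha : a n
    · simp only [word_succ_of_false ha, sub_self]
      have : iteratedDeriv k (0 : ℝ → ℝ) x = 0 := by
        refine (iteratedDeriv_const (n := k) (c := (0 : ℝ)) (𝕜 := ℝ)).trans ?_
        simp
      rw [this, abs_zero]
      positivity
    · simp only [word_succ_of_true ha]
      exact h.close β hβ a n k hk x

theorem smoothLift_conjRot (h : IsTower α φ D s) (hv : IsWordLimit φ a v) :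
    SmoothLift (conjRot v α) := by
  refine ⟨(h.conjRot_limit hv (.inl rfl)).1, ?_⟩
  rw [conjRot_inv]
  exact (h.conjRot_limit hv (.inr rfl)).1

theorem limit_zero (h : IsTower α φ D s) (hv : IsWordLimit φ a v) : v 0 = 0 := by
  refine tendsto_nhds_unique (hv.tendsto 0) ?_
  simp only [h.word_zero]
  exact tendsto_const_nhds

theorem abs_iteratedDeriv_sub_le (h : IsTower α φ D s) (hv : IsWordLimit φ a v)
    (hw : IsWordLimit φ b w) {n : ℕ} (hab : ∀ i < n, a i = b i) {β : ℝ} (hβ : β = α ∨ β = -α)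
    {k : ℕ} (hk : k ≤ n) (x : ℝ) :
    |iteratedDeriv k (⇑(conjRot v β : CircleDeg1Lift) - ⇑(conjRot w β : CircleDeg1Lift)) x|
      ≤ 4 * (1 / 2) ^ n := by
  obtain ⟨sv, hv'⟩ := h.conjRot_limit hv hβ
  obtain ⟨sw, hw'⟩ := h.conjRot_limit hw hβ
  have hs := h.smoothLift_word a n
  have sn : ContDiff ℝ ∞ (conjRot (word φ a n) β) :=
    hs.contDiff.comp ((contDiff_rot β).comp hs.contDiff_inv)
  have h1 := hv' n k hk x
  have h2 := hw' n k hk x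
  rw [← word_congr hab] at h2
  have le : (k : WithTop ℕ∞) ≤ ∞ := by exact_mod_cast le_top
  rw [iteratedDeriv_sub (sv.of_le le).contDiffAt (sn.of_le le).contDiffAt] at h1
  rw [iteratedDeriv_sub (sw.of_le le).contDiffAt (sn.of_le le).contDiffAt] at h2
  rw [iteratedDeriv_sub (sv.of_le le).contDiffAt (sw.of_le le).contDiffAt]
  rw [abs_sub_comm] at h2
  refine (abs_sub_le _ (iteratedDeriv k (⇑(conjRot (word φ a n) β : CircleDeg1Lift)) x) _).trans ?_
  linarith

theorem distK_le (h : IsTower α φ D s) (hv : IsWordLimit φ a v) (hw : IsWordLimit φ b w) {n : ℕ}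
    (hab : ∀ i < n, a i = b i) {k : ℕ} (hk : k ≤ n) :
    CircleDiffeo.distK k (toCircleDiffeo (conjRot v α) (h.smoothLift_conjRot hv))
      (toCircleDiffeo (conjRot w α) (h.smoothLift_conjRot hw)) ≤ 4 * (1 / 2) ^ n := by
  have sv := h.smoothLift_conjRot hv
  have sw := h.smoothLift_conjRot hw
  refine max_le (normGap_toCircleHomeo_le sv.contDiff sw.contDiff fun i hi x =>
      h.abs_iteratedDeriv_sub_le hv hw hab (.inl rfl) (hi.trans hk) x)
    (normGap_toCircleHomeo_le (u := (conjRot v α)⁻¹) (v := (conjRot w α)⁻¹)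
      sv.contDiff_inv sw.contDiff_inv fun i hi x => ?_)
  rw [conjRot_inv, conjRot_inv]
  exact h.abs_iteratedDeriv_sub_le hv hw hab (.inr rfl) (hi.trans hk) x

/-- If two sequences agree from `N` on, the infinite products differ by a finite product. -/
theorem tail_eq (hv : IsWordLimit φ a v) (hw : IsWordLimit φ b w) {N : ℕ}
    (hab : ∀ n, N ≤ n → a n = b n) : (word φ a N)⁻¹ * v = (word φ b N)⁻¹ * w := by
  have key : ∀ m, (word φ a N)⁻¹ * word φ a (m + N) = (word φ b N)⁻¹ * word φ b (m + N) := by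
    intro m
    induction m with
    | zero => simp
    | succ m ih =>
      rw [Nat.succ_add, word, word, ← mul_assoc, ← mul_assoc, ih, hab (m + N) (by omega)]
  have lim : ∀ (c : ℕ → Bool) (u : CircleDeg1Liftˣ), IsWordLimit φ c u → ∀ x,
      Tendsto (fun m => ((word φ c N)⁻¹ * word φ c (m + N) : CircleDeg1Liftˣ) x) atTop
        (𝓝 (((word φ c N)⁻¹ * u : CircleDeg1Liftˣ) x)) := fun c u hu x =>
    ((continuous_unit (word φ c N)⁻¹).tendsto _).comp
      ((tendsto_add_atTop_iff_nat N).2 (hu.tendsto x))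
  refine Units.ext (CircleDeg1Lift.ext fun x => tendsto_nhds_unique (lim a v hv x) ?_)
  simp only [key]
  exact lim b w hw x

theorem abs_sub_mul_D_le (h : IsTower α φ D s) (a : ℕ → Bool) (n : ℕ) (x y : ℝ) :
    |x - y| * D n ≤ |word φ a n x - word φ a n y| := by
  have h1 := h.lipschitz_inv a n (word φ a n x) (word φ a n y)
  rw [CircleDeg1Lift.units_inv_apply_apply, CircleDeg1Lift.units_inv_apply_apply] at h1
  have hD := h.D_pos n
  rw [div_mul_eq_mul_div, le_div_iff₀ hD] at h1
  have : (1 / 2 : ℝ) ^ n ≤ 1 := pow_le_one₀ (by norm_num) (by norm_num)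
  exact h1.trans (mul_le_of_le_one_left (abs_nonneg _) this)

theorem abs_word_sub_le_pow (h : IsTower α φ D s) (a : ℕ → Bool) (n : ℕ) {x y : ℝ}
    (hxy : |x - y| ≤ 2 * s n) : |word φ a n x - word φ a n y| ≤ D n ^ n := by
  have hD := h.D_pos n
  have h1 : (1 / 2 : ℝ) ^ n ≤ 1 := pow_le_one₀ (by norm_num) (by norm_num)
  calc |word φ a n x - word φ a n y| ≤ (1 / 2) ^ n / D n * |x - y| := h.lipschitz a n x y
    _ ≤ 1 / D n * (2 * D n ^ (n + 2)) := by
        gcongr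
        linarith [h.s_le n]
    _ = 2 * D n * D n ^ n := by
        field_simp
        ring
    _ ≤ 1 * D n ^ n := by
        gcongr
        linarith [h.D_le_eighth n]
    _ = D n ^ n := one_mul _

/-- A conjugacy between two infinite products stretches some interval at each level where the
sequences differ. -/
theorem exists_stretched (h : IsTower α φ D s) (hv : IsWordLimit φ a v) (hw : IsWordLimit φ b w)
    (t : ℝ) {n : ℕ} (hn : a n ≠ b n) : ∃ x y, |x - y| ≤ D n ^ n ∧
      D n ^ 2 / 8 ≤ |(v * rot t * w⁻¹ : CircleDeg1Liftˣ) x -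
        (v * rot t * w⁻¹ : CircleDeg1Liftˣ) y| := by
  have hD := h.D_pos n
  have hs := h.D_succ_le n
  have hsD := h.s_le_D_div n
  have hs0 := (h.stretch n).pos_s
  set Ta := (word φ a (n + 1))⁻¹ * v with hTa
  set Tb := (word φ b (n + 1))⁻¹ * w with hTb
  have ea : v = word φ a (n + 1) * Ta := by rw [hTa]; group
  have eb : w = word φ b (n + 1) * Tb := by rw [hTb]; group
  rcases ha : a n
  · have hb : b n = true := by
      rcases hb : b n
      · exact absurd (ha.trans hb.symm) hn
      · rfl
    obtain ⟨x, y, hxy, hst⟩ := (h.stretch n).stretch_inv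
    refine ⟨word φ b n x, word φ b n y, h.abs_word_sub_le_pow b n (by linarith), ?_⟩
    have e : v * rot t * w⁻¹ * word φ b n
        = word φ a n * (Ta * (rot t * (Tb⁻¹ * (φ n)⁻¹))) := by
      rw [ea, eb, word_succ_of_false ha, word_succ_of_true hb]
      group
    have e' : ∀ z, (v * rot t * w⁻¹ : CircleDeg1Liftˣ) (word φ b n z)
        = word φ a n (Ta (rot t ((Tb⁻¹ : CircleDeg1Liftˣ) ((φ n)⁻¹ z)))) := fun z =>
      congrArg (fun u : CircleDeg1Liftˣ => u z) e
    rw [e', e']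
    have h1 := abs_le.1 (abs_apply_rot_apply_sub_le (h.abs_tail_sub_le hv (n + 1))
      (h.abs_tail_inv_sub_le hw (n + 1)) t ((φ n)⁻¹ x) ((φ n)⁻¹ y))
    have h2 := h.abs_sub_mul_D_le a n (Ta (rot t ((Tb⁻¹ : CircleDeg1Liftˣ) ((φ n)⁻¹ x))))
      (Ta (rot t ((Tb⁻¹ : CircleDeg1Liftˣ) ((φ n)⁻¹ y))))
    refine le_trans ?_ h2
    have h3 : D n / 8 ≤ |Ta (rot t ((Tb⁻¹ : CircleDeg1Liftˣ) ((φ n)⁻¹ x))) -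
        Ta (rot t ((Tb⁻¹ : CircleDeg1Liftˣ) ((φ n)⁻¹ y)))| := by
      rcases le_abs.1 hst with hst | hst
      · exact le_abs.2 (.inl (by linarith [h1.1, h1.2]))
      · exact le_abs.2 (.inr (by linarith [h1.1, h1.2]))
    nlinarith
  · have hb : b n = false := by
      rcases hb : b n
      · rfl
      · exact absurd (ha.trans hb.symm) hn
    obtain ⟨x, y, hxy, hst⟩ := (h.stretch n).stretch
    refine ⟨word φ b n (Tb (rot (-t) ((Ta⁻¹ : CircleDeg1Liftˣ) x))),
      word φ b n (Tb (rot (-t) ((Ta⁻¹ : CircleDeg1Liftˣ) y))), h.abs_word_sub_le_pow b n ?_, ?_⟩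
    · have h1 := abs_le.1 (abs_apply_rot_apply_sub_le (h.abs_tail_sub_le hw (n + 1))
        (h.abs_tail_inv_sub_le hv (n + 1)) (-t) x y)
      have h2 := abs_le.1 hxy
      rw [abs_le]
      constructor <;> linarith [h1.1, h1.2, h2.1, h2.2]
    · have e : v * rot t * w⁻¹ * (word φ b n * (Tb * (rot (-t) * Ta⁻¹)))
          = word φ a n * φ n := by
        rw [← word_succ_of_false hb, ← word_succ_of_true ha, ← rot_inv, hTa, hTb]
        group
      have e' : ∀ z, (v * rot t * w⁻¹ : CircleDeg1Liftˣ)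
          (word φ b n (Tb (rot (-t) ((Ta⁻¹ : CircleDeg1Liftˣ) z)))) = word φ a n (φ n z) := fun z =>
        congrArg (fun u : CircleDeg1Liftˣ => u z) e
      rw [e', e']
      refine le_trans ?_ (h.abs_sub_mul_D_le a n _ _)
      nlinarith

/-- The infinite products determine the sequences. -/
theorem limit_injective (h : IsTower α φ D s) (hv : IsWordLimit φ a v) (hw : IsWordLimit φ b v) :
    a = b := by
  by_contra hab
  have hex : ∃ n, a n ≠ b n := by
    by_contra hne
    push Not at hne
    exact hab (funext hne)
  classical
  have hn := Nat.find_spec hex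
  have hlt : ∀ i < Nat.find hex, a i = b i := fun i hi => not_not.1 (Nat.find_min hex hi)
  generalize Nat.find hex = n at hn hlt
  have main : ∀ {a b : ℕ → Bool}, IsWordLimit φ a v → IsWordLimit φ b v →
      (∀ i < n, a i = b i) → a n = true → b n = false → False := by
    intro a b hv hw hlt ha hb
    obtain ⟨x, y, hxy, hst⟩ := (h.stretch n).stretch
    set Ta := (word φ a (n + 1))⁻¹ * v with hTa
    set Tb := (word φ b (n + 1))⁻¹ * v with hTb
    have e : Tb * (rot 0 * Ta⁻¹) = φ n := by
      have : rot 0 = 1 := Units.ext (CircleDeg1Lift.ext fun z => by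
        rw [rot_apply, add_zero]; rfl)
      rw [this, hTa, hTb, word_succ_of_true ha, word_succ_of_false hb, word_congr hlt]
      group
    have e' : ∀ z, Tb (rot 0 ((Ta⁻¹ : CircleDeg1Liftˣ) z)) = φ n z := fun z =>
      congrArg (fun u : CircleDeg1Liftˣ => u z) e
    have h1 := abs_apply_rot_apply_sub_le (h.abs_tail_sub_le hw (n + 1))
      (h.abs_tail_inv_sub_le hv (n + 1)) 0 x y
    rw [e', e'] at h1
    have h2 := abs_sub_abs_le_abs_sub (φ n x - φ n y) (x - y)
    linarith [h.D_succ_le n, h.s_le_D_div n, h.D_pos n]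
  rcases ha : a n
  · rcases hb : b n
    · exact hn (ha.trans hb.symm)
    · exact main hw hv (fun i hi => (hlt i hi).symm) hb ha
  · rcases hb : b n
    · exact main hv hw hlt ha hb
    · exact hn (ha.trans hb.symm)

theorem not_holder (h : IsTower α φ D s) (hv : IsWordLimit φ a v) (hw : IsWordLimit φ b w)
    (t : ℝ) (hab : {n | a n ≠ b n}.Infinite) {C β : ℝ} (hC : 0 ≤ C) (hβ : 0 < β) :
    ¬ ∀ x y, |x - y| ≤ 1 → |(v * rot t * w⁻¹ : CircleDeg1Liftˣ) x -
        (v * rot t * w⁻¹ : CircleDeg1Liftˣ) y| ≤ C * |x - y| ^ β := by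
  intro hH
  have hD0 : Tendsto D atTop (𝓝 0) := by
    refine squeeze_zero (fun n => (h.D_pos n).le) h.D_le_half_pow ?_
    exact tendsto_pow_atTop_nhds_zero_of_lt_one (by norm_num) (by norm_num)
  have ev : ∀ᶠ n in atTop, C * D n < 1 / 8 ∧ 3 ≤ n * β := by
    refine Eventually.and ?_ ?_
    · have := hD0.const_mul C
      rw [mul_zero] at this
      exact this.eventually (gt_mem_nhds (by norm_num))
    · exact (tendsto_natCast_atTop_atTop.atTop_mul_const hβ).eventually_ge_atTop 3
  obtain ⟨n, hn, h1, h2⟩ := ((Nat.frequently_atTop_iff_infinite.2 hab).and_eventually ev).exists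
  obtain ⟨x, y, hxy, hst⟩ := h.exists_stretched hv hw t hn
  have hD := h.D_pos n
  have hD1 : D n ≤ 1 := (h.D_le_eighth n).trans (by norm_num)
  have h3 := hst.trans (hH x y (hxy.trans (pow_le_one₀ hD.le hD1)))
  have h4 : |x - y| ^ β ≤ D n ^ 3 :=
    calc |x - y| ^ β ≤ (D n ^ n) ^ β := by gcongr
      _ = D n ^ (n * β) := by rw [← Real.rpow_natCast_mul hD.le]
      _ ≤ D n ^ (3 : ℝ) := Real.rpow_le_rpow_of_exponent_ge hD hD1 h2
      _ = D n ^ 3 := by norm_cast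
  have h5 : D n ^ 2 / 8 ≤ C * D n * D n ^ 2 :=
    calc D n ^ 2 / 8 ≤ C * |x - y| ^ β := h3
      _ ≤ C * D n ^ 3 := by gcongr
      _ = C * D n * D n ^ 2 := by ring
  have h6 : 0 < D n ^ 2 := by positivity
  nlinarith

end IsTower

end CircleDyn

end

theorem mainTheorem2 (α : ℝ) (hα : Liouville α) :
    ∃ Ψ : (ℕ → Bool) → CircleDyn.DiffeoWithRotationNumber (α : UnitAddCircle),
      Continuous Ψ ∧ Function.Injective Ψ ∧
        ∀ a b : ℕ → Bool,
          ((∃ N : ℕ, ∀ n, N ≤ n → a n = b n) →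
            CircleDyn.CircleDiffeo.SmoothConjugate (Ψ a).1 (Ψ b).1) ∧
          ({n : ℕ | a n ≠ b n}.Infinite →
            ¬ CircleDyn.CircleDiffeo.HolderConjugate (Ψ a).1 (Ψ b).1) := by
  open CircleDyn in
  obtain ⟨φ, D, s, h⟩ := exists_isTower hα
  choose Φ hΦ using h.exists_isWordLimit
  refine ⟨fun a => ⟨toCircleDiffeo (conjRot (Φ a) α) (h.smoothLift_conjRot (hΦ a)), ?_⟩,
    ?_, ?_, fun a b => ⟨?_, ?_⟩⟩
  · refine (rotationNumber_toCircleHomeo _).trans ?_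
    rw [translationNumber_conjRot]
  · refine Continuous.subtype_mk (continuous_iff_continuousAt.2 fun a => ?_) _
    refine tendsto_distInf_of_tendsto_distK fun k => ?_
    rw [Metric.tendsto_nhds]
    intro ε hε
    have ht : Filter.Tendsto (fun n : ℕ => 4 * (1 / 2 : ℝ) ^ n) Filter.atTop (nhds 0) := by
      simpa using (tendsto_pow_atTop_nhds_zero_of_lt_one (r := (1 / 2 : ℝ)) (by norm_num)
        (by norm_num)).const_mul 4
    obtain ⟨n, hn, hkn⟩ := ((ht.eventually (gt_mem_nhds hε)).and
      (Filter.eventually_ge_atTop k)).exists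
    have hev : ∀ᶠ b : ℕ → Bool in nhds a, ∀ i ∈ Finset.range n, b i = a i := by
      rw [Filter.eventually_all_finset]
      intro i _
      have := (continuous_apply (A := fun _ : ℕ => Bool) i).tendsto a
      rw [nhds_discrete Bool, Filter.tendsto_pure] at this
      exact this
    filter_upwards [hev] with b hb
    rw [Real.dist_eq, sub_zero, abs_of_nonneg (CircleDiffeo.distK_nonneg _ _ _)]
    exact (h.distK_le (hΦ b) (hΦ a) (fun i hi => hb i (Finset.mem_range.2 hi)) hkn).trans_lt hn
  · intro a b hab
    have e : (toCircleHomeo (conjRot (Φ a) α)) = toCircleHomeo (conjRot (Φ b) α) :=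
      congrArg (fun f => f.1.toCircleHomeo) hab
    have hl := isLift_toCircleHomeo (conjRot (Φ b) α)
    rw [← e] at hl
    obtain ⟨m, hm⟩ := hl.eq_add_int (isLift_toCircleHomeo (conjRot (Φ a) α))
    obtain ⟨t, ht⟩ := eq_mul_rot_mul_inv hα.irrational (g := 1) hm
    have ht' : Φ b = Φ a * rot t := by
      have : 1 * Φ b = Φ a * rot t * (Φ b)⁻¹ * Φ b := by rw [← ht]
      simpa using this
    have h0 : Φ a 0 = Φ a t := by
      have := congrArg (fun u : CircleDeg1Liftˣ => u 0) ht'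
      simp only [unit_mul_apply, rot_apply, zero_add] at this
      rw [← this, h.limit_zero (hΦ a), h.limit_zero (hΦ b)]
    have h1 : t = 0 := by
      have := congrArg ((Φ a)⁻¹ : CircleDeg1Liftˣ) h0
      rw [CircleDeg1Lift.units_inv_apply_apply, CircleDeg1Lift.units_inv_apply_apply] at this
      exact this.symm
    have h2 : Φ b = Φ a := Units.ext (CircleDeg1Lift.ext fun x => by
      rw [ht', unit_mul_apply, rot_apply, h1, add_zero])
    exact h.limit_injective (hΦ a) (h2 ▸ hΦ b)
  · rintro ⟨N, hN⟩
    have ht := IsTower.tail_eq (hΦ a) (hΦ b) hN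
    set g := word φ a N * (word φ b N)⁻¹ with hg
    have hs : SmoothLift g := (h.smoothLift_word a N).mul (h.smoothLift_word b N).inv
    have e : conjRot (Φ a) α = g * conjRot (Φ b) α * g⁻¹ := by
      have : Φ a = g * Φ b := by rw [hg, mul_assoc, ← ht]; group
      rw [this, conjRot, conjRot]
      group
    refine ⟨toCircleDiffeo g hs, fun y => ?_⟩
    obtain ⟨x, rfl⟩ := QuotientAddGroup.mk_surjective y
    change ((conjRot (Φ a) α x : ℝ) : UnitAddCircle) = _
    rw [e]
    rfl
  · rintro hab ⟨f, ⟨C, β, hβ, -, hf⟩, hconj⟩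
    obtain ⟨g, hg⟩ := CircleDeg1Lift.isUnit_iff_bijective.2 f.lift_bijective
    have hgl : IsLift g f := hg ▸ f.isLift_lift
    have h1 : IsLift (g * conjRot (Φ b) α : CircleDeg1Liftˣ)
        (fun y => f (toCircleHomeo (conjRot (Φ b) α) y)) :=
      ⟨continuous_unit _, fun x => hgl.2 _⟩
    have h2 : IsLift (conjRot (Φ a) α * g : CircleDeg1Liftˣ)
        (fun y => f (toCircleHomeo (conjRot (Φ b) α) y)) := by
      refine ⟨continuous_unit _, fun x => ?_⟩
      have h3 := hconj (f (x : UnitAddCircle))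
      have h4 : f.symm (f (x : UnitAddCircle)) = x := f.toHomeo.symm_apply_apply _
      rw [h4, ← hgl.2] at h3
      exact h3
    obtain ⟨m, hm⟩ := h1.eq_add_int h2
    obtain ⟨t, ht⟩ := eq_mul_rot_mul_inv hα.irrational hm
    refine h.not_holder (hΦ a) (hΦ b) t hab (C := 2 * C) (β := β) (by positivity)
      (by exact_mod_cast hβ) ?_
    rw [← ht]
    exact fun x y hxy => holder_of_isLift hf hgl hxy
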